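/- Let $\mathbb G$ be a locally compact Hausdorff abelian group, written additively, and let $\mathbf\Gamma$ be its character group (continuous homomorphisms $\gamma$ from $\mathbb G$ to the unit circle, with the topology of uniform convergence on compact sets), also written additively; write $(x,\gamma)=\gamma(x)$. Let $\mu_{\mathbb G}$ and $\mu_{\mathbf\Gamma}$ be (regular) Haar measures on $\mathbb G$ and $\mathbf\Gamma$, put $\hat f(\gamma)=\int_{\mathbb G} f(x)\overline{(x,\gamma)}\,d\mu_{\mathbb G}(x)$, and call $f:\mathbb G\to\mathbb C$ *regular* if it is continuous and integrable and $\|\hat f\|_1=\int_{\mathbf\Gamma}|\hat f|\,d\mu_{\mathbf\Gamma}<\infty$. Let $R$ be a $\mathbb G$-valued random variable whose law $\mu_R$ is a Radon probability measure with $\mathbb P(R=0)=0$, let $\lambda>0$ be real and $m\ge 1$ an integer. A *triple Poisson tower* is a family $X=(X^{(j)}_k)_{k\in\mathbb Z,\,j=1,2,3}$ of mutually independent $\mathbb G$-valued random variables such that $X^{(j)}_k\sim\sum_{r=1}^{N}R_r$, where $N$ is Poisson with mean $\lambda e^{-k/m}$ and the $R_r$ are i.i.d. copies of $R$, independent of $N$.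 Define $$\phi_{f,m}(X)=\int_{\mathbf\Gamma}\hat f(\gamma)\,\frac{\prod_{j=1}^3\Big(\sum_{k=-\infty}^{\infty}\big((X^{(j)}_k,\gamma)-1\big)e^{\frac13 k/m}\Big)}{m^3\,|\Gamma(-1/3)|^3}\,d\mu_{\mathbf\Gamma}(\gamma),$$ $\widehat{\mu_R}(\gamma)=\mathbb E\,(R,-\gamma)$, and the *variance factor* $$\begin{aligned}\alpha_{f,R}=-\int_{\mathbf\Gamma}\int_{\mathbf\Gamma}&\hat f(\gamma)\overline{\hat f(\gamma')}\Big[\big(1-\widehat{\mu_R}(-\gamma+\gamma')\big)^{2/3}-\big(2-\widehat{\mu_R}(-\gamma)-\widehat{\mu_R}(\gamma')\big)^{2/3}\Big]\\&\times\big(1-\widehat{\mu_R}(-\gamma)\big)^{2/3}\big(1-\widehat{\mu_R}(\gamma')\big)^{2/3}\,d\mu_{\mathbf\Gamma}(\gamma)\,d\mu_{\mathbf\Gamma}(\gamma'),\end{aligned}$$ with principal powers. For a complex random variable $Y$ let $\mathbb V\,Y=\mathbb E\big((Y-\mathbb EY)\overline{(Y-\mathbb EY)}\big)$. **Theorem.**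 For every regular $f$, the series in $\phi_{f,m}(X)$ converge absolutely for all $\gamma$ and $j$, and the integral defining $\phi_{f,m}(X)$ converges absolutely, almost surely; $\phi_{f,m}(X)$ is square integrable; the iterated integral defining $\alpha_{f,R}$ converges absolutely at each of its two stages; and $$\mathbb V\,\phi_{f,m}(X)=3m^{-1}\lambda^2\,(-\Gamma(-2/3))\,\Gamma(-1/3)^{-2}\,\alpha_{f,R}+\lambda^2\|\hat f\|_1^2\,O(m^{-2}),$$ where the constant in $O(m^{-2})$ is absolute: the error term is at most $C\lambda^2\|\hat f\|_1^2m^{-2}$ in absolute value, with $C$ independent of $\mathbb G$, the Haar measures, $R$, $f$, $\lambda$, $m$ and $X$. -/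

import Mathlib

open MeasureTheory ProbabilityTheory

noncomputable section

namespace PoissonTower

/-- The character group of an additive topological group `G`, written multiplicatively: continuous
homomorphisms from `G` to the unit circle, with the topology of uniform convergence on compacts.
Thus `γ * γ'` and `γ⁻¹` stand for the sum `γ + γ'` and the negative `-γ` of characters. -/
abbrev Dual (G : Type*) [AddCommGroup G] [TopologicalSpace G] : Type _ :=
  PontryaginDual (Multiplicative G)

/-- The pairing `(x, γ) = γ(x)`, as a complex number. -/
def pairing {G : Type*} [AddCommGroup G] [TopologicalSpace G] (x : G) (γ : Dual G) : ℂ :=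
  ((γ (Multiplicative.ofAdd x) : Circle) : ℂ)

/-- The Fourier transform `f̂(γ) = ∫ f(x) conj (x, γ) dμ(x)`. -/
def fourierTransform {G : Type*} [AddCommGroup G] [TopologicalSpace G] [MeasurableSpace G]
    (μG : Measure G) (f : G → ℂ) (γ : Dual G) : ℂ :=
  ∫ x, f x * starRingEnd ℂ (pairing x γ) ∂μG

/-- Regular functions: continuous, integrable, and with integrable Fourier transform. -/
structure IsRegularFunction {G : Type*} [AddCommGroup G] [TopologicalSpace G] [MeasurableSpace G]
    [MeasurableSpace (Dual G)] (μG : Measure G) (μΓ : Measure (Dual G)) (f : G → ℂ) : Prop where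
  continuous : Continuous f
  integrable : Integrable f μG
  integrable_fourier : Integrable (fourierTransform μG f) μΓ

/-- The law of the sum of `n` independent variables of law `μ`, i.e. the `n`-fold convolution power
of `μ`. The convolution of `μ` and `ν` is taken in the form `B ↦ ∫ ν(B - x) dμ(x)`, which makes
sense for Radon measures on any locally compact group: addition on `G` need not be measurable for
the product of the Borel σ-algebras if `G` is not second countable. -/
def sumLaw {G : Type*} [AddCommGroup G] [MeasurableSpace G] (μ : Measure G) : ℕ → Measure G
  | 0 => Measure.dirac 0
  | n + 1 => μ.bind fun x => (sumLaw μ n).map fun y => x + y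

/-- The law of `∑_{r=1}^N R_r`, where the `R_r` have law `μ`, the number `N` of terms has the
Poisson law of mean `t ≥ 0`, and all of these variables are independent. -/
def compoundPoisson {G : Type*} [AddCommGroup G] [MeasurableSpace G] (t : ℝ) (μ : Measure G) :
    Measure G :=
  (poissonMeasure t.toNNReal).bind (sumLaw μ)

/-- Triple Poisson tower: mutually independent cells `X j k`, for `j` in a three-element set and
`k ∈ ℤ`, the cell `X j k` having the law of a sum of `Poisson(lam * e^{-k/m})` many
independent copies of a variable of law `μR`. -/
structure IsTriplePoissonTower {G : Type*} [AddCommGroup G] [MeasurableSpace G]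
    {Ω : Type*} [MeasurableSpace Ω] (P : Measure Ω) (μR : Measure G) (lam : ℝ) (m : ℕ)
    (X : Fin 3 → ℤ → Ω → G) : Prop where
  measurable : ∀ j k, Measurable (X j k)
  indep : iIndepFun (fun p : Fin 3 × ℤ => X p.1 p.2) P
  law : ∀ j k, P.map (X j k) = compoundPoisson (lam * Real.exp (-((k : ℝ) / m))) μR

/-- The `k`-th term `((x_k, γ) - 1) e^{k/(3m)}` of the `(-1/3)`-aggregation. -/
def aggregationTerm {G : Type*} [AddCommGroup G] [TopologicalSpace G] (m : ℕ) (x : ℤ → G)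
    (γ : Dual G) (k : ℤ) : ℂ :=
  (pairing (x k) γ - 1) * (Real.exp (1 / 3 * ((k : ℝ) / m)) : ℂ)

/-- The `(-1/3)`-aggregation `U_γ = ∑_{k ∈ ℤ} ((x_k, γ) - 1) e^{k/(3m)}`. -/
def aggregation {G : Type*} [AddCommGroup G] [TopologicalSpace G] (m : ℕ) (x : ℤ → G)
    (γ : Dual G) : ℂ :=
  ∑' k : ℤ, aggregationTerm m x γ k

/-- The integrand `f̂(γ) V_γ / (m³ |Γ(-1/3)|³)`, where `V_γ` is the product of the three
aggregations. -/
def estimatorIntegrand {G : Type*} [AddCommGroup G] [TopologicalSpace G] [MeasurableSpace G]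
    (μG : Measure G) (f : G → ℂ) (m : ℕ) (x : Fin 3 → ℤ → G) (γ : Dual G) : ℂ :=
  fourierTransform μG f γ *
    ((∏ j : Fin 3, aggregation m (x j) γ) / (((m : ℝ) ^ 3 * |Real.Gamma (-1 / 3)| ^ 3 : ℝ) : ℂ))

/-- The Poisson tower estimator `φ_{f,m}`, as a function of the content of the triple tower. -/
def estimator {G : Type*} [AddCommGroup G] [TopologicalSpace G] [MeasurableSpace G]
    [MeasurableSpace (Dual G)] (μG : Measure G) (μΓ : Measure (Dual G)) (f : G → ℂ) (m : ℕ)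
    (x : Fin 3 → ℤ → G) : ℂ :=
  ∫ γ, estimatorIntegrand μG f m x γ ∂μΓ

/-- The variance `E ((Y - E Y) conj (Y - E Y))` of a complex random variable. -/
def complexVariance {Ω : Type*} [MeasurableSpace Ω] (P : Measure Ω) (Y : Ω → ℂ) : ℂ :=
  ∫ ω, (Y ω - ∫ ω', Y ω' ∂P) * starRingEnd ℂ (Y ω - ∫ ω', Y ω' ∂P) ∂P

/-- The Fourier–Stieltjes transform `μ̂_R(γ) = E (R, -γ)`. -/
def fourierStieltjes {G : Type*} [AddCommGroup G] [TopologicalSpace G] [MeasurableSpace G]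
    (μR : Measure G) (γ : Dual G) : ℂ :=
  ∫ x, pairing x γ⁻¹ ∂μR

/-- The integrand of the variance factor; the powers are principal powers of complex numbers of
nonnegative real part. -/
def varianceKernel {G : Type*} [AddCommGroup G] [TopologicalSpace G] [MeasurableSpace G]
    (μG : Measure G) (μR : Measure G) (f : G → ℂ) (γ γ' : Dual G) : ℂ :=
  fourierTransform μG f γ * starRingEnd ℂ (fourierTransform μG f γ') *
    ((1 - fourierStieltjes μR (γ⁻¹ * γ')) ^ (2 / 3 : ℂ)
      - (2 - fourierStieltjes μR γ⁻¹ - fourierStieltjes μR γ') ^ (2 / 3 : ℂ)) *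
    (1 - fourierStieltjes μR γ⁻¹) ^ (2 / 3 : ℂ) * (1 - fourierStieltjes μR γ') ^ (2 / 3 : ℂ)

/-- The variance factor `α_{f,R}`. -/
def varianceFactor {G : Type*} [AddCommGroup G] [TopologicalSpace G] [MeasurableSpace G]
    [MeasurableSpace (Dual G)] (μG : Measure G) (μΓ : Measure (Dual G)) (μR : Measure G)
    (f : G → ℂ) : ℂ :=
  -∫ γ', ∫ γ, varianceKernel μG μR f γ γ' ∂μΓ ∂μΓ

end PoissonTower

end

/-! The variance of `∫ H γ dγ` is the double integral of the covariances of the values `H γ` and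
`H γ'`, so that the variance of the estimator is determined by the covariances of the integrand at
pairs of characters. Each of these is a product of three independent copies of the aggregation `U`;
if `α`, `β` are the means of `U γ` and of the conjugate of `U γ'`, and `B` is their covariance, the
products have covariance `(αβ + B)³ - (αβ)³ = 3 (αβ)² B + 3 αβ B² + B³`.

Let `ψ γ = 1 - E (R, γ)` be the exponent of the compound Poisson laws. By independence of the cells
and the formula `E (X k, γ) = exp (-lam e^{-k/m} ψ γ)`, the mean of `U γ` is
`laplaceSum (1 / 3) m (lam * ψ γ)`, and `B` is a difference of values of `laplaceSum (2 / 3) m`,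
at `lam * ψ (γ - γ')` and at `lam * (ψ γ + conj (ψ γ'))` (`integral_aggregation_mul_conj`). Now
`laplaceSum a m z` is a Riemann sum for `m Γ(-a) z ^ a = m ∫ (exp (-u z) - 1) u ^ (-a - 1) du`, with
an error of size `‖z‖ (re z) ^ (a - 1)`, bounded in `m` (`norm_laplaceSum_sub_le`). Thus `α` and `β`
are of order `m lam ^ (1 / 3)`, `B` is of order `m lam ^ (2 / 3)`, and after division by the square
of the normalization `m³ |Γ(-1/3)|³` the term `3 (αβ)² B` contributes at order `1 / m` while the
others contribute at order `1 / m²`.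

The constant has to be absolute, which is delicate near the imaginary axis, where the error bound
for the means degenerates. There `B` is small: `B` is Hölder continuous of exponent `2 / 3`, and
`‖ψ (γ - γ') - ψ γ - conj (ψ γ')‖` is at most twice the geometric mean of the real parts of `ψ γ`
and `ψ γ'`, by the Cauchy-Schwarz inequality (`norm_exponent_mul_inv_sub_sq_le`). Together with
`‖ψ‖² ≤ 2 re ψ` this bounds the product of `B` and the errors of the means, which is all that
matters (`exists_norm_covariance_sub_le`).

The use of Fubini's theorem rests on two facts. The aggregations are dominated for all characters at
once by `weightSum`, which has a finite second moment (`lintegral_weightSum_sq_lt_top`). And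
although the pairing need not be measurable for the product of the Borel σ-algebras, it is measurable
for product measures that live on σ-compact sets, on which the laws of all cells and the measure
`‖f̂‖ dμΓ` are concentrated. The same fact makes the variance kernel integrable. -/

noncomputable section

namespace PoissonTower

open Filter Topology Set
open scoped ENNReal NNReal

/-! ### Riemann sums over the integers -/

/-- The sum of a function over the integers approximates its integral up to its total variation. -/
theorem summable_int_and_norm_tsum_sub_integral_le {g g' : ℝ → ℂ}
    (hd : ∀ x, HasDerivAt g (g' x) x) (hg : Integrable g) (hg' : Integrable g') :
    Summable (fun k : ℤ => g k) ∧ ‖(∑' k : ℤ, g k) - ∫ x, g x‖ ≤ ∫ x, ‖g' x‖ := by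
  have h1 : HasSum (fun n : ℤ => ∫ x in (n : ℝ)..n + 1, g x) (∫ x, g x) := by
    simpa using hg.hasSum_intervalIntegral 0
  have h2 : HasSum (fun n : ℤ => ∫ x in (n : ℝ)..n + 1, ‖g' x‖) (∫ x, ‖g' x‖) := by
    simpa using hg'.norm.hasSum_intervalIntegral 0
  have hcont : Continuous g := continuous_iff_continuousAt.2 fun x => (hd x).continuousAt
  have h3 : ∀ n : ℤ, ‖(∫ x in (n : ℝ)..n + 1, g x) - g n‖ ≤ ∫ x in (n : ℝ)..n + 1, ‖g' x‖ := by
    intro n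
    have e : (∫ x in (n : ℝ)..n + 1, g x) - g n = ∫ x in (n : ℝ)..n + 1, (g x - g n) := by
      rw [intervalIntegral.integral_sub (hcont.intervalIntegrable _ _) (by simp)]
      simp
    rw [e]
    have := intervalIntegral.norm_integral_le_of_norm_le_const (a := (n : ℝ)) (b := n + 1)
      (f := fun x => g x - g n) (C := ∫ x in (n : ℝ)..n + 1, ‖g' x‖) ?_
    · simpa using this
    · intro x hx
      rw [uIoc_of_le (by linarith)] at hx
      rw [← intervalIntegral.integral_eq_sub_of_hasDerivAt (fun y _ => hd y)
        hg'.intervalIntegrable]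
      refine (intervalIntegral.norm_integral_le_integral_norm hx.1.le).trans ?_
      exact intervalIntegral.integral_mono_interval le_rfl hx.1.le hx.2
        (Eventually.of_forall fun _ => norm_nonneg _) hg'.norm.intervalIntegrable
  have h4 : Summable fun n : ℤ => (∫ x in (n : ℝ)..n + 1, g x) - g n :=
    Summable.of_norm_bounded h2.summable h3
  have h5 : Summable (fun k : ℤ => g k) := by
    simpa using h1.summable.sub h4
  refine ⟨h5, ?_⟩
  rw [norm_sub_rev, ← h1.tsum_eq, ← h1.summable.tsum_sub h5, ← h2.tsum_eq]
  exact tsum_of_norm_bounded h2.summable.hasSum h3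

/-! ### The Gamma integral with complex rate -/

theorem integrableOn_rpow_mul_exp_neg_mul {b r : ℝ} (hb : 0 < b) (hr : 0 < r) :
    IntegrableOn (fun u : ℝ => u ^ (b - 1) * Real.exp (-(u * r))) (Ioi 0) := by
  have := integrableOn_rpow_mul_exp_neg_mul_rpow (p := 1) (s := b - 1) (b := r)
    (by linarith) one_pos hr
  refine this.congr_fun (fun x hx => ?_) measurableSet_Ioi
  simp [mul_comm]

theorem norm_exp_neg_mul (u : ℝ) (z : ℂ) :
    ‖Complex.exp (-(u * z))‖ = Real.exp (-(u * z.re)) := by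
  simp [Complex.norm_exp]

theorem integrableOn_rpow_mul_cexp_neg_mul {b : ℝ} {z : ℂ} (hb : 0 < b) (hz : 0 < z.re) :
    IntegrableOn (fun u : ℝ => ((u ^ (b - 1) : ℝ) : ℂ) * Complex.exp (-(u * z))) (Ioi 0) := by
  refine (integrableOn_rpow_mul_exp_neg_mul hb hz).mono' (by fun_prop) ?_
  refine (ae_restrict_mem measurableSet_Ioi).mono fun u hu => ?_
  have hu : 0 < u := hu
  rw [norm_mul, norm_exp_neg_mul, Complex.norm_real, Real.norm_of_nonneg (by positivity)]

theorem integral_rpow_mul_exp_neg_mul {b r : ℝ} (hb : 0 < b) (hr : 0 < r) :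
    ∫ u in Ioi (0 : ℝ), u ^ (b - 1) * Real.exp (-(u * r)) = r ^ (-b) * Real.Gamma b := by
  have := Real.integral_rpow_mul_exp_neg_mul_Ioi hb hr
  simp_rw [mul_comm _ r]
  rw [this, one_div, Real.inv_rpow hr.le, Real.rpow_neg hr.le]

/-- The Gamma integral with complex rate: both sides are analytic in the open right half-plane and
agree on the positive reals. -/
theorem integral_rpow_mul_cexp_neg_mul {b : ℝ} {z : ℂ} (hb : 0 < b) (hz : 0 < z.re) :
    ∫ u in Ioi (0 : ℝ), ((u ^ (b - 1) : ℝ) : ℂ) * Complex.exp (-(u * z))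
      = z ^ (-(b : ℂ)) * (Real.Gamma b : ℂ) := by
  set U : Set ℂ := {z | 0 < z.re} with hU
  have hUo : IsOpen U := isOpen_lt continuous_const Complex.continuous_re
  have hUc : IsPreconnected U := (convex_halfSpace_re_gt 0).isPreconnected
  have hF : AnalyticOnNhd ℂ (fun z : ℂ => ∫ u in Ioi (0 : ℝ),
      ((u ^ (b - 1) : ℝ) : ℂ) * Complex.exp (-(u * z))) U := by
    refine DifferentiableOn.analyticOnNhd (fun w hw => ?_) hUo
    have hw : 0 < w.re := hw
    have hs : {v : ℂ | w.re / 2 < v.re} ∈ 𝓝 w :=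
      (isOpen_lt continuous_const Complex.continuous_re).mem_nhds (by simp; linarith)
    have := hasDerivAt_integral_of_dominated_loc_of_deriv_le
      (μ := volume.restrict (Ioi (0 : ℝ))) (x₀ := w)
      (F := fun (z : ℂ) (u : ℝ) => ((u ^ (b - 1) : ℝ) : ℂ) * Complex.exp (-(u * z)))
      (F' := fun (z : ℂ) (u : ℝ) => ((u ^ (b - 1) : ℝ) : ℂ) * (Complex.exp (-(u * z)) * (-u)))
      (bound := fun u => u ^ (b + 1 - 1) * Real.exp (-(u * (w.re / 2)))) hs
      (Eventually.of_forall fun z => by fun_prop)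
      (integrableOn_rpow_mul_cexp_neg_mul hb hw) (by fun_prop)
      ?_ (integrableOn_rpow_mul_exp_neg_mul (by linarith) (by linarith)) ?_
    · exact this.2.differentiableAt.differentiableWithinAt
    · refine (ae_restrict_mem measurableSet_Ioi).mono fun u hu v hv => ?_
      have hu : 0 < u := hu
      have hv : w.re / 2 < v.re := hv
      rw [norm_mul, norm_mul, norm_exp_neg_mul, Complex.norm_real,
        Real.norm_of_nonneg (by positivity), norm_neg, Complex.norm_real,
        Real.norm_of_nonneg hu.le]
      have e : u ^ (b + 1 - 1) = u ^ (b - 1) * u := by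
        rw [← Real.rpow_add_one hu.ne']; ring_nf
      rw [e]
      have : Real.exp (-(u * v.re)) ≤ Real.exp (-(u * (w.re / 2))) := by
        apply Real.exp_le_exp.2; nlinarith
      calc _ = u ^ (b - 1) * u * Real.exp (-(u * v.re)) := by ring
        _ ≤ _ := by gcongr
    · refine Eventually.of_forall fun u v _ => ?_
      have h : HasDerivAt (fun z : ℂ => -((u : ℂ) * z)) (-(u : ℂ)) v := by
        simpa using ((hasDerivAt_id' v).const_mul (u : ℂ)).fun_neg
      exact h.cexp.const_mul _
  have hG : AnalyticOnNhd ℂ (fun z : ℂ => z ^ (-(b : ℂ)) * (Real.Gamma b : ℂ)) U := by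
    refine DifferentiableOn.analyticOnNhd (fun w hw => ?_) hUo
    have : w ∈ Complex.slitPlane := Or.inl hw
    exact (((hasDerivAt_id w).cpow_const this).differentiableAt.mul_const _).differentiableWithinAt
  refine hF.eqOn_of_preconnected_of_frequently_eq hG hUc (z₀ := 1) (by simp [hU]) ?_ hz
  have key : ∀ r : ℝ, 0 < r → (∫ u in Ioi (0 : ℝ),
      ((u ^ (b - 1) : ℝ) : ℂ) * Complex.exp (-(u * (r : ℂ))))
        = (r : ℂ) ^ (-(b : ℂ)) * (Real.Gamma b : ℂ) := by
    intro r hr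
    rw [← Complex.ofReal_neg, ← Complex.ofReal_cpow hr.le, ← Complex.ofReal_mul,
      ← integral_rpow_mul_exp_neg_mul hb hr, ← integral_complex_ofReal]
    refine integral_congr_ae (Eventually.of_forall fun u => ?_)
    push_cast
    rfl
  have ht : Tendsto (fun n : ℕ => ((1 + 1 / ((n : ℝ) + 1) : ℝ) : ℂ)) atTop (𝓝[≠] 1) := by
    refine tendsto_nhdsWithin_iff.2 ⟨?_, Eventually.of_forall fun n => ?_⟩
    · have : Tendsto (fun n : ℕ => (1 : ℝ) + 1 / ((n : ℝ) + 1)) atTop (𝓝 (1 + 0)) :=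
        tendsto_const_nhds.add tendsto_one_div_add_atTop_nhds_zero_nat
      rw [add_zero] at this
      exact (Complex.continuous_ofReal.tendsto 1).comp this
    · have : (0 : ℝ) < 1 / ((n : ℝ) + 1) := by positivity
      rw [mem_compl_singleton_iff]
      intro h
      have h' : (1 + 1 / ((n : ℝ) + 1) : ℝ) = 1 := by exact_mod_cast h
      linarith
  exact ht.frequently (Frequently.of_forall fun n => key _ (by positivity))

/-! ### The substitution `u = exp (-s / M)` -/

theorem image_exp_neg_div {M : ℝ} (hM : 0 < M) :
    (fun s : ℝ => Real.exp (-(s / M))) '' univ = Ioi 0 := by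
  ext x
  simp only [image_univ, mem_range, mem_Ioi]
  constructor
  · rintro ⟨y, rfl⟩; positivity
  · intro hx
    exact ⟨-(M * Real.log x), by rw [neg_div, neg_neg, mul_div_cancel_left₀ _ hM.ne',
      Real.exp_log hx]⟩

theorem hasDerivAt_exp_neg_div (M s : ℝ) :
    HasDerivAt (fun s : ℝ => Real.exp (-(s / M))) (-(Real.exp (-(s / M)) / M)) s := by
  have := ((hasDerivAt_id' s).div_const M).fun_neg.exp
  convert this using 1
  ring

theorem injective_exp_neg_div {M : ℝ} (hM : 0 < M) :
    Function.Injective (fun s : ℝ => Real.exp (-(s / M))) := by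
  intro x y h
  have := Real.exp_injective h
  have := neg_injective this
  field_simp at this
  exact this

theorem integral_exp_neg_div_smul {E : Type*} [NormedAddCommGroup E] [NormedSpace ℝ E]
    {M : ℝ} (hM : 0 < M) (h : ℝ → E) :
    ∫ s, Real.exp (-(s / M)) • h (Real.exp (-(s / M))) = M • ∫ u in Ioi (0 : ℝ), h u := by
  rw [← image_exp_neg_div hM, integral_image_eq_integral_abs_deriv_smul MeasurableSet.univ
    (fun x _ => (hasDerivAt_exp_neg_div M x).hasDerivWithinAt)
    (injective_exp_neg_div hM).injOn, setIntegral_univ, ← integral_smul]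
  refine integral_congr_ae (Eventually.of_forall fun s => ?_)
  simp only [abs_neg, smul_smul]
  rw [abs_of_pos (by positivity), mul_div_cancel₀ _ hM.ne']

theorem integrable_exp_neg_div_smul {E : Type*} [NormedAddCommGroup E] [NormedSpace ℝ E]
    {M : ℝ} (hM : 0 < M) {h : ℝ → E} (hh : IntegrableOn h (Ioi 0)) :
    Integrable (fun s => Real.exp (-(s / M)) • h (Real.exp (-(s / M)))) := by
  rw [← image_exp_neg_div hM, integrableOn_image_iff_integrableOn_abs_deriv_smul MeasurableSet.univ
    (fun x _ => (hasDerivAt_exp_neg_div M x).hasDerivWithinAt)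
    (injective_exp_neg_div hM).injOn, integrableOn_univ] at hh
  refine (hh.smul M).congr (Eventually.of_forall fun s => ?_)
  simp only [Pi.smul_apply, abs_neg, smul_smul]
  rw [abs_of_pos (by positivity), mul_div_cancel₀ _ hM.ne']

/-! ### The sums `∑ₖ (exp (-e^{-k/m} z) - 1) e^{ak/m}` -/

theorem norm_exp_neg_le_one {w : ℂ} (hw : 0 ≤ w.re) : ‖Complex.exp (-w)‖ ≤ 1 := by
  rw [Complex.norm_exp]; simpa using hw

theorem norm_exp_neg_sub_exp_neg_le {w w' : ℂ} (hw : 0 ≤ w.re) (hw' : 0 ≤ w'.re) :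
    ‖Complex.exp (-w) - Complex.exp (-w')‖ ≤ min 2 ‖w - w'‖ := by
  refine le_min ?_ ?_
  · refine (norm_sub_le _ _).trans ?_
    linarith [norm_exp_neg_le_one hw, norm_exp_neg_le_one hw']
  · have hd : ∀ x ∈ {z : ℂ | 0 ≤ z.re}, HasDerivWithinAt (fun z => Complex.exp (-z))
        (Complex.exp (-x) * (-1)) {z : ℂ | 0 ≤ z.re} x := fun x _ =>
      ((hasDerivAt_id' x).fun_neg.cexp).hasDerivWithinAt
    have := (convex_halfSpace_re_ge 0).norm_image_sub_le_of_norm_hasDerivWithin_le hd (C := 1)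
      (fun x hx => by simpa using norm_exp_neg_le_one hx) hw' hw
    simpa using this

theorem min_two_le_three_mul_one_sub_exp_neg {x : ℝ} (hx : 0 ≤ x) :
    min 2 x ≤ 3 * (1 - Real.exp (-x)) := by
  have h1 : Real.exp (-x) ≤ 1 / (1 + x) := by
    rw [Real.exp_neg, one_div]
    exact inv_anti₀ (by linarith) (by linarith [Real.add_one_le_exp x])
  have h2 : min 2 x ≤ 3 * (1 - 1 / (1 + x)) := by
    have e : 3 * (1 - 1 / (1 + x)) = 3 * x / (1 + x) := by field_simp; ring
    rw [e, le_div_iff₀ (by linarith)]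
    rcases le_total 2 x with h | h
    · rw [min_eq_left h]; linarith
    · rw [min_eq_right h]; nlinarith
  linarith

/-- The function `s ↦ (exp (-e^{-s/m} z) - 1) e^{as/m}`, the increment at `s = k` of the Riemann
sum for the Gamma integral `∫ (e^{-uz} - 1) u^{-a-1} du`. -/
def laplaceTerm (a m : ℝ) (z : ℂ) (s : ℝ) : ℂ :=
  (Complex.exp (-((Real.exp (-(s / m)) : ℝ) * z)) - 1) * (Real.exp (a * (s / m)) : ℝ)

/-- The sum of `laplaceTerm` over the integers. -/
def laplaceSum (a m : ℝ) (z : ℂ) : ℂ := ∑' k : ℤ, laplaceTerm a m z k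

/-- The derivative of `laplaceTerm`, up to a factor `m` and a multiple of `laplaceTerm` itself. -/
def laplaceDeriv (a m : ℝ) (z : ℂ) (s : ℝ) : ℂ :=
  Real.exp (-(s / m)) • ((((Real.exp (-(s / m))) ^ ((1 - a) - 1) : ℝ) : ℂ) *
    Complex.exp (-((Real.exp (-(s / m)) : ℝ) * z)) * z)

theorem exp_rpow_sub (a m s : ℝ) :
    (Real.exp (-(s / m))) ^ ((1 - a) - 1) = Real.exp (a * (s / m)) := by
  rw [← Real.exp_mul]; congr 1; ring

theorem hasDerivAt_laplaceTerm (a m : ℝ) (z : ℂ) (s : ℝ) :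
    HasDerivAt (laplaceTerm a m z)
      ((m⁻¹ : ℝ) • (laplaceDeriv a m z s + (a : ℂ) * laplaceTerm a m z s)) s := by
  have h1 : HasDerivAt (fun s : ℝ => ((Real.exp (-(s / m)) : ℝ) : ℂ) * z)
      (((-(Real.exp (-(s / m)) / m) : ℝ) : ℂ) * z) s :=
    (hasDerivAt_exp_neg_div m s).ofReal_comp.mul_const z
  have h2 : HasDerivAt (fun s : ℝ => ((Real.exp (a * (s / m)) : ℝ) : ℂ))
      ((Real.exp (a * (s / m)) * (a * (1 / m)) : ℝ) : ℂ) s :=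
    (((hasDerivAt_id' s).div_const m).const_mul a).exp.ofReal_comp
  have := (h1.fun_neg.cexp.sub_const 1).mul h2
  refine this.congr_deriv ?_
  simp only [laplaceDeriv, laplaceTerm, exp_rpow_sub, Complex.real_smul]
  push_cast
  ring

theorem conj_laplaceTerm (a m : ℝ) (z : ℂ) (s : ℝ) :
    starRingEnd ℂ (laplaceTerm a m z s) = laplaceTerm a m (starRingEnd ℂ z) s := by
  simp only [laplaceTerm, map_mul, map_sub, map_one, Complex.conj_ofReal, ← Complex.exp_conj,
    map_neg]

theorem conj_laplaceSum (a m : ℝ) (z : ℂ) :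
    starRingEnd ℂ (laplaceSum a m z) = laplaceSum a m (starRingEnd ℂ z) := by
  simp only [laplaceSum, Complex.conj_tsum, conj_laplaceTerm]

section

variable {a m : ℝ} {z : ℂ}

theorem exp_mul_re_nonneg (hz : 0 ≤ z.re) (u : ℝ) : 0 ≤ (((Real.exp u : ℝ) : ℂ) * z).re := by
  rw [Complex.re_ofReal_mul]; positivity

theorem norm_laplaceTerm_le (hz : 0 ≤ z.re) (s : ℝ) :
    ‖laplaceTerm a m z s‖ ≤ min 2 (Real.exp (-(s / m)) * ‖z‖) * Real.exp (a * (s / m)) := by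
  rw [laplaceTerm, norm_mul, Complex.norm_real, Real.norm_of_nonneg (Real.exp_pos _).le]
  gcongr
  have := norm_exp_neg_sub_exp_neg_le (w' := 0) (exp_mul_re_nonneg hz (-(s / m))) (by simp)
  simpa only [neg_zero, Complex.exp_zero, sub_zero, norm_mul, Complex.norm_real,
    Real.norm_of_nonneg (Real.exp_pos _).le] using this

@[fun_prop]
theorem continuous_laplaceTerm (a m : ℝ) (z : ℂ) : Continuous (laplaceTerm a m z) := by
  unfold laplaceTerm; fun_prop

theorem integrable_laplaceTerm (ha : 0 < a) (ha' : a < 1) (hm : 0 < m) (hz : 0 ≤ z.re) :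
    Integrable (laplaceTerm a m z) := by
  rw [← integrableOn_univ, ← Iic_union_Ioi (a := (0 : ℝ)), integrableOn_union]
  constructor
  · refine ((integrableOn_exp_mul_Iic (a := a / m) (by positivity) 0).const_mul 2).mono'
      (by fun_prop) (Eventually.of_forall fun s => ?_)
    refine (norm_laplaceTerm_le hz s).trans ?_
    rw [mul_div_left_comm, mul_comm s]
    gcongr
    exact min_le_left _ _
  · refine ((integrableOn_exp_mul_Ioi (a := (a - 1) / m) (div_neg_of_neg_of_pos (by linarith) hm)
      0).const_mul ‖z‖).mono' (by fun_prop) (Eventually.of_forall fun s => ?_)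
    refine (norm_laplaceTerm_le hz s).trans ?_
    calc _ ≤ Real.exp (-(s / m)) * ‖z‖ * Real.exp (a * (s / m)) := by
          gcongr; exact min_le_right _ _
      _ = ‖z‖ * (Real.exp (-(s / m)) * Real.exp (a * (s / m))) := by ring
      _ = _ := by rw [← Real.exp_add]; congr 2; ring

theorem integrable_laplaceDeriv (ha' : a < 1) (hm : 0 < m) (hz : 0 < z.re) :
    Integrable (laplaceDeriv a m z) :=
  integrable_exp_neg_div_smul hm (h := fun u : ℝ => ((u ^ ((1 - a) - 1) : ℝ) : ℂ) *
    Complex.exp (-((u : ℝ) * z)) * z)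
    ((integrableOn_rpow_mul_cexp_neg_mul (by linarith) hz).mul_const z)

theorem integral_laplaceDeriv (ha' : a < 1) (hm : 0 < m) (hz : 0 < z.re) :
    ∫ s, laplaceDeriv a m z s = m * ((Real.Gamma (1 - a) : ℂ) * z ^ (a : ℂ)) := by
  have hz0 : z ≠ 0 := by rintro rfl; simp at hz
  have := integral_exp_neg_div_smul hm (fun u : ℝ => ((u ^ ((1 - a) - 1) : ℝ) : ℂ) *
    Complex.exp (-((u : ℝ) * z)) * z)
  refine this.trans ?_
  rw [integral_mul_const, integral_rpow_mul_cexp_neg_mul (by linarith) hz, Complex.real_smul,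
    mul_right_comm, mul_comm (_ * z)]
  congr 2
  nth_rw 2 [← Complex.cpow_one z]
  rw [← Complex.cpow_add _ _ hz0]
  push_cast; congr 1; ring

theorem integral_norm_laplaceDeriv (ha' : a < 1) (hm : 0 < m) (hz : 0 < z.re) :
    ∫ s, ‖laplaceDeriv a m z s‖ = m * (Real.Gamma (1 - a) * (‖z‖ * z.re ^ (a - 1))) := by
  have := integral_exp_neg_div_smul hm (fun u : ℝ => u ^ ((1 - a) - 1) *
    Real.exp (-(u * z.re)) * ‖z‖)
  rw [integral_mul_const, integral_rpow_mul_exp_neg_mul (by linarith) hz] at this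
  trans ∫ s, Real.exp (-(s / m)) • ((Real.exp (-(s / m))) ^ ((1 - a) - 1) *
    Real.exp (-((Real.exp (-(s / m))) * z.re)) * ‖z‖)
  · refine integral_congr_ae (Eventually.of_forall fun s => ?_)
    simp only [laplaceDeriv, norm_smul, norm_mul, norm_exp_neg_mul, Complex.norm_real]
    rw [Real.norm_of_nonneg (by positivity), Real.norm_of_nonneg (by positivity)]
    simp
  · rw [this, neg_sub, smul_eq_mul]; ring

theorem gamma_one_sub_eq (ha : 0 < a) : Real.Gamma (1 - a) = -a * Real.Gamma (-a) := by
  rw [← Real.Gamma_add_one (by linarith)]; ring_nf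

theorem neg_gamma_neg_pos (ha : 0 < a) (ha' : a < 1) : 0 < -Real.Gamma (-a) := by
  have := gamma_one_sub_eq ha
  have h2 : 0 < Real.Gamma (1 - a) := Real.Gamma_pos_of_pos (by linarith)
  rw [this] at h2
  nlinarith

theorem integral_laplaceTerm (ha : 0 < a) (ha' : a < 1) (hm : 0 < m) (hz : 0 < z.re) :
    ∫ s, laplaceTerm a m z s = m * (Real.Gamma (-a) : ℂ) * z ^ (a : ℂ) := by
  have hi := integrable_laplaceTerm ha ha' hm hz.le
  have hk := integrable_laplaceDeriv ha' hm hz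
  have hi' : Integrable fun s =>
    (m⁻¹ : ℝ) • (laplaceDeriv a m z s + (a : ℂ) * laplaceTerm a m z s) :=
    (hk.add (hi.const_mul (a : ℂ))).smul m⁻¹
  have h := integral_eq_zero_of_hasDerivAt_of_integrable (hasDerivAt_laplaceTerm a m z) hi' hi
  rw [integral_smul, smul_eq_zero, integral_add hk (hi.const_mul _), integral_const_mul,
    integral_laplaceDeriv ha' hm hz, gamma_one_sub_eq ha] at h
  have h := h.resolve_left (by positivity)
  have ha0 : (a : ℂ) ≠ 0 := by exact_mod_cast ha.ne'
  refine mul_left_cancel₀ ha0 ?_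
  push_cast at h
  linear_combination h

theorem laplaceTerm_ofReal (r s : ℝ) : laplaceTerm a m r s =
    (-((1 - Real.exp (-(Real.exp (-(s / m)) * r))) * Real.exp (a * (s / m))) : ℝ) := by
  simp only [laplaceTerm]; push_cast; ring

theorem integral_one_sub_exp (ha : 0 < a) (ha' : a < 1) (hm : 0 < m) {r : ℝ} (hr : 0 < r) :
    ∫ s, (1 - Real.exp (-(Real.exp (-(s / m)) * r))) * Real.exp (a * (s / m))
      = m * -Real.Gamma (-a) * r ^ a := by
  have := integral_laplaceTerm ha ha' hm (z := r) (by simpa using hr)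
  simp_rw [laplaceTerm_ofReal] at this
  rw [integral_complex_ofReal, integral_neg, ← Complex.ofReal_cpow hr.le] at this
  have h : (-(∫ s, (1 - Real.exp (-(Real.exp (-(s / m)) * r))) * Real.exp (a * (s / m))) : ℝ)
    = m * Real.Gamma (-a) * r ^ a := by exact_mod_cast this
  linarith

theorem integrable_one_sub_exp (ha : 0 < a) (ha' : a < 1) (hm : 0 < m) {r : ℝ} (hr : 0 ≤ r) :
    Integrable fun s : ℝ => (1 - Real.exp (-(Real.exp (-(s / m)) * r))) *
      Real.exp (a * (s / m)) := by
  have := (integrable_laplaceTerm ha ha' hm (z := r) (by simpa using hr)).re.neg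
  refine this.congr (Eventually.of_forall fun s => ?_)
  simp [laplaceTerm_ofReal, -Complex.ofReal_neg, -Complex.ofReal_mul]

theorem min_mul_exp_le {r : ℝ} (hr : 0 ≤ r) (s : ℝ) :
    min 2 (Real.exp (-(s / m)) * r) * Real.exp (a * (s / m)) ≤
      3 * ((1 - Real.exp (-(Real.exp (-(s / m)) * r))) * Real.exp (a * (s / m))) := by
  rw [← mul_assoc]
  gcongr
  exact min_two_le_three_mul_one_sub_exp_neg (by positivity)

theorem integral_norm_laplaceTerm_le (ha : 0 < a) (ha' : a < 1) (hm : 0 < m) (hz : 0 ≤ z.re)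
    (hz0 : z ≠ 0) :
    ∫ s, ‖laplaceTerm a m z s‖ ≤ m * (3 * -Real.Gamma (-a)) * ‖z‖ ^ a := by
  have hr : 0 < ‖z‖ := norm_pos_iff.2 hz0
  refine (integral_mono (integrable_laplaceTerm ha ha' hm hz).norm
    ((integrable_one_sub_exp ha ha' hm hr.le).const_mul 3) fun s =>
      (norm_laplaceTerm_le hz s).trans (min_mul_exp_le hr.le s)).trans ?_
  rw [integral_const_mul, integral_one_sub_exp ha ha' hm hr]
  exact le_of_eq (by ring)

theorem re_eq_zero_of_norm_sq_le {c : ℝ} (hz : ‖z‖ ^ 2 ≤ c * z.re) (h0 : z.re = 0) : z = 0 := by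
  rw [h0, mul_zero] at hz
  exact norm_eq_zero.1 (pow_eq_zero_iff two_ne_zero |>.1 (le_antisymm hz (sq_nonneg _)))

theorem laplaceTerm_zero (a m s : ℝ) : laplaceTerm a m 0 s = 0 := by simp [laplaceTerm]

theorem laplaceSum_zero (a m : ℝ) : laplaceSum a m 0 = 0 := by simp [laplaceSum, laplaceTerm_zero]

/-- The constant of `norm_laplaceSum_sub_le`. -/
def riemannConst (a : ℝ) : ℝ := Real.Gamma (1 - a) + a * (3 * -Real.Gamma (-a))

theorem summable_laplaceTerm_and_norm_sub_le (ha : 0 < a) (ha' : a < 1) (hm : 0 < m)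
    (hz : 0 < z.re) :
    Summable (fun k : ℤ => laplaceTerm a m z k) ∧
    ‖laplaceSum a m z - m * (Real.Gamma (-a) : ℂ) * z ^ (a : ℂ)‖
      ≤ riemannConst a * (‖z‖ * z.re ^ (a - 1)) := by
  have hz0 : z ≠ 0 := by rintro rfl; simp at hz
  have hi := integrable_laplaceTerm ha ha' hm hz.le
  have hk := integrable_laplaceDeriv ha' hm hz
  have hi' : Integrable fun s =>
    (m⁻¹ : ℝ) • (laplaceDeriv a m z s + (a : ℂ) * laplaceTerm a m z s) :=
    (hk.add (hi.const_mul (a : ℂ))).smul m⁻¹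
  obtain ⟨h1, h2⟩ := summable_int_and_norm_tsum_sub_integral_le
    (hasDerivAt_laplaceTerm a m z) hi hi'
  refine ⟨h1, ?_⟩
  rw [integral_laplaceTerm ha ha' hm hz] at h2
  refine h2.trans ?_
  have h3 : ∫ s, ‖(m⁻¹ : ℝ) • (laplaceDeriv a m z s + (a : ℂ) * laplaceTerm a m z s)‖
      ≤ ∫ s, m⁻¹ * (‖laplaceDeriv a m z s‖ + a * ‖laplaceTerm a m z s‖) := by
    refine integral_mono hi'.norm ((hk.norm.add (hi.norm.const_mul a)).const_mul _) fun s => ?_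
    simp only [norm_smul, norm_inv, Real.norm_of_nonneg hm.le]
    gcongr
    refine (norm_add_le _ _).trans ?_
    rw [norm_mul, Complex.norm_real, Real.norm_of_nonneg ha.le]
  refine h3.trans ?_
  rw [integral_const_mul, integral_add hk.norm (hi.norm.const_mul a), integral_const_mul,
    integral_norm_laplaceDeriv ha' hm hz]
  have h4 := integral_norm_laplaceTerm_le ha ha' hm hz.le hz0
  have h5 : ‖z‖ ^ a ≤ ‖z‖ * z.re ^ (a - 1) := by
    have hr : 0 < ‖z‖ := norm_pos_iff.2 hz0
    calc ‖z‖ ^ a = ‖z‖ * ‖z‖ ^ (a - 1) := by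
          rw [mul_comm, ← Real.rpow_add_one hr.ne']; ring_nf
      _ ≤ _ := by
          gcongr ?_ * ?_
          exact Real.rpow_le_rpow_of_nonpos hz (Complex.re_le_norm z) (by linarith)
  have hG := neg_gamma_neg_pos ha ha'
  rw [inv_mul_le_iff₀ hm]
  calc _ ≤ m * (Real.Gamma (1 - a) * (‖z‖ * z.re ^ (a - 1)))
        + a * (m * (3 * -Real.Gamma (-a)) * (‖z‖ * z.re ^ (a - 1))) := by
          gcongr; exact h4.trans (by gcongr)
    _ = _ := by rw [riemannConst]; ring

/-- The sum `laplaceSum a m z` is `m Γ(-a) z ^ a` up to an error that does not grow with `m`. The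
error bound degenerates as `z` approaches the imaginary axis. -/
theorem norm_laplaceSum_sub_le (ha : 0 < a) (ha' : a < 1) (hm : 0 < m) {c : ℝ} (hz : 0 ≤ z.re)
    (hzc : ‖z‖ ^ 2 ≤ c * z.re) :
    ‖laplaceSum a m z - m * (Real.Gamma (-a) : ℂ) * z ^ (a : ℂ)‖
      ≤ riemannConst a * (‖z‖ * z.re ^ (a - 1)) := by
  rcases hz.eq_or_lt with h | h
  · have := re_eq_zero_of_norm_sq_le hzc h.symm
    have ha0 : (a : ℂ) ≠ 0 := by exact_mod_cast ha.ne'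
    simp [this, laplaceSum_zero, Complex.zero_cpow ha0]
  · exact (summable_laplaceTerm_and_norm_sub_le ha ha' hm h).2

/-- The constant of `summable_min_mul_exp_and_tsum_le`. -/
def minConst (a : ℝ) : ℝ := 3 * (-Real.Gamma (-a) + riemannConst a)

/-- A Riemann sum for `∫ min (2, ur) u ^ (-a - 1) du`; on the positive reals there is no
degeneration of the error, and `min (2, x)` is comparable to `1 - exp (-x)`. -/
theorem summable_min_mul_exp_and_tsum_le (ha : 0 < a) (ha' : a < 1) (hm : 1 ≤ m) {r : ℝ}
    (hr : 0 ≤ r) :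
    Summable (fun k : ℤ => min 2 (Real.exp (-(k / m)) * r) * Real.exp (a * (k / m))) ∧
    ∑' k : ℤ, min 2 (Real.exp (-(k / m)) * r) * Real.exp (a * (k / m))
      ≤ minConst a * m * r ^ a := by
  rcases hr.eq_or_lt with rfl | hr
  · simp [Real.zero_rpow ha.ne', summable_zero]
  obtain ⟨h1, h2⟩ := summable_laplaceTerm_and_norm_sub_le ha ha' (by linarith : 0 < m) (z := r)
    (by simpa using hr)
  have h3 : Summable fun k : ℤ => (1 - Real.exp (-(Real.exp (-(k / m)) * r))) *
      Real.exp (a * (k / m)) := by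
    simp_rw [laplaceTerm_ofReal] at h1
    simpa using (Complex.summable_ofReal.1 h1).neg
  have h4 : Summable fun k : ℤ => min 2 (Real.exp (-(k / m)) * r) * Real.exp (a * (k / m)) :=
    Summable.of_nonneg_of_le (fun k => by positivity) (fun k => min_mul_exp_le hr.le k)
      (h3.mul_left 3)
  refine ⟨h4, ?_⟩
  refine (h4.tsum_le_tsum (fun k : ℤ => min_mul_exp_le hr.le (k : ℝ)) (h3.mul_left 3)).trans ?_
  rw [tsum_mul_left]
  set T := ∑' k : ℤ, (1 - Real.exp (-(Real.exp (-(k / m)) * r))) * Real.exp (a * (k / m)) with hT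
  have h5 : laplaceSum a m r = ((-T : ℝ) : ℂ) := by
    simp_rw [laplaceSum, laplaceTerm_ofReal]
    rw [← Complex.ofReal_tsum, tsum_neg]
  rw [h5, ← Complex.ofReal_cpow hr.le, ← Complex.ofReal_mul, ← Complex.ofReal_mul,
    ← Complex.ofReal_sub, Complex.norm_real, Complex.norm_real, Complex.ofReal_re,
    Real.norm_of_nonneg hr.le, Real.norm_eq_abs] at h2
  have h6 : r * r ^ (a - 1) = r ^ a := by
    rw [mul_comm, ← Real.rpow_add_one hr.ne']; ring_nf
  rw [h6] at h2
  have h7 := (abs_le.1 h2).1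
  have hc : 0 ≤ riemannConst a := by
    have hG := neg_gamma_neg_pos ha ha'
    have h2 : 0 < Real.Gamma (1 - a) := Real.Gamma_pos_of_pos (by linarith)
    unfold riemannConst; positivity
  have hp : 0 < r ^ a := by positivity
  have h8 : riemannConst a * r ^ a ≤ m * (riemannConst a * r ^ a) :=
    le_mul_of_one_le_left (by positivity) hm
  unfold minConst
  nlinarith

theorem summable_laplaceTerm (ha : 0 < a) (ha' : a < 1) (hm : 1 ≤ m) (hz : 0 ≤ z.re) :
    Summable (fun k : ℤ => laplaceTerm a m z k) :=
  Summable.of_norm_bounded (summable_min_mul_exp_and_tsum_le ha ha' hm (norm_nonneg z)).1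
    fun k => norm_laplaceTerm_le hz k

/-- Hölder continuity of `laplaceSum`, uniformly up to the imaginary axis. -/
theorem norm_laplaceSum_sub_laplaceSum_le (ha : 0 < a) (ha' : a < 1) (hm : 1 ≤ m) {w : ℂ}
    (hz : 0 ≤ z.re) (hw : 0 ≤ w.re) :
    ‖laplaceSum a m z - laplaceSum a m w‖ ≤ minConst a * m * ‖z - w‖ ^ a := by
  obtain ⟨h1, h2⟩ := summable_min_mul_exp_and_tsum_le ha ha' hm (norm_nonneg (z - w))
  rw [laplaceSum, laplaceSum, ← (summable_laplaceTerm ha ha' hm hz).tsum_sub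
    (summable_laplaceTerm ha ha' hm hw)]
  refine (tsum_of_norm_bounded h1.hasSum fun k => ?_).trans h2
  rw [laplaceTerm, laplaceTerm, ← sub_mul, sub_sub_sub_cancel_right, norm_mul, Complex.norm_real,
    Real.norm_of_nonneg (Real.exp_pos _).le]
  gcongr
  have := norm_exp_neg_sub_exp_neg_le (exp_mul_re_nonneg hz (-((k : ℝ) / m)))
    (exp_mul_re_nonneg hw (-((k : ℝ) / m)))
  rwa [← mul_sub, norm_mul, Complex.norm_real, Real.norm_of_nonneg (Real.exp_pos _).le] at this

theorem norm_laplaceSum_le (ha : 0 < a) (ha' : a < 1) (hm : 1 ≤ m) (hz : 0 ≤ z.re) :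
    ‖laplaceSum a m z‖ ≤ minConst a * m * ‖z‖ ^ a := by
  simpa [laplaceSum_zero] using norm_laplaceSum_sub_laplaceSum_le ha ha' hm hz (w := 0) (by simp)

end

/-! ### The covariance of a product of three aggregations, for a fixed pair of characters -/

theorem ofReal_mul_cpow {r : ℝ} (hr : 0 < r) (z : ℂ) {c : ℂ} (hc : c ≠ 0) :
    ((r : ℂ) * z) ^ c = (r : ℂ) ^ c * z ^ c := by
  rcases eq_or_ne z 0 with rfl | hz
  · simp [Complex.zero_cpow hc]
  have hr' : (r : ℂ) ≠ 0 := by exact_mod_cast hr.ne'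
  rw [Complex.cpow_def_of_ne_zero (mul_ne_zero hr' hz), Complex.cpow_def_of_ne_zero hr',
    Complex.cpow_def_of_ne_zero hz, Complex.log_ofReal_mul hr hz, Complex.ofReal_log hr.le,
    add_mul, Complex.exp_add]

theorem ofReal_pow_three_mul_cpow_third_sq {Λ : ℝ} (hΛ : 0 < Λ) (z : ℂ) :
    ((((Λ ^ 3 : ℝ) : ℂ) * z) ^ (((1 / 3 : ℝ) : ℝ) : ℂ)) ^ 2 = (Λ : ℂ) ^ 2 * z ^ (2 / 3 : ℂ) := by
  rw [ofReal_mul_cpow (by positivity) _ (by norm_num), mul_pow,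
    ← Complex.ofReal_cpow (by positivity), ← Real.rpow_natCast, ← Real.rpow_mul hΛ.le,
    ← Complex.cpow_mul_nat]
  norm_num

theorem ofReal_pow_three_mul_cpow_two_thirds {Λ : ℝ} (hΛ : 0 < Λ) (z : ℂ) :
    (((Λ ^ 3 : ℝ) : ℂ) * z) ^ (((2 / 3 : ℝ) : ℝ) : ℂ) = (Λ : ℂ) ^ 2 * z ^ (2 / 3 : ℂ) := by
  rw [ofReal_mul_cpow (by positivity) _ (by norm_num), ← Complex.ofReal_cpow (by positivity),
    ← Real.rpow_natCast, ← Real.rpow_mul hΛ.le]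
  have e : ((3 : ℕ) : ℝ) * (2 / 3) = ((2 : ℕ) : ℝ) := by norm_num
  rw [e, Real.rpow_natCast]
  norm_num

theorem rpow_third_pow_three {x : ℝ} (hx : 0 ≤ x) : (x ^ (1 / 3 : ℝ)) ^ 3 = x := by
  rw [← Real.rpow_natCast, ← Real.rpow_mul hx]; norm_num

theorem rpow_two_thirds {x : ℝ} (hx : 0 ≤ x) : x ^ (2 / 3 : ℝ) = (x ^ (1 / 3 : ℝ)) ^ 2 := by
  rw [← Real.rpow_natCast, ← Real.rpow_mul hx]; norm_num

/-- For `w` in a disc tangent to the imaginary axis at `0`, bounds for the cube roots of `‖w‖` and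
`w.re`. -/
theorem cube_root_bounds {w : ℂ} {Λ : ℝ} (hΛ : 0 < Λ) (hw : 0 ≤ w.re)
    (h : ‖w‖ ^ 2 ≤ 4 * Λ ^ 3 * w.re) :
    ‖w‖ ^ (1 / 3 : ℝ) ≤ 2 * Λ ∧ (‖w‖ ^ (1 / 3 : ℝ)) ^ 2 ≤ 2 * Λ * w.re ^ (1 / 3 : ℝ) ∧
      w.re ^ (1 / 3 : ℝ) ≤ 2 * Λ := by
  have hx := rpow_third_pow_three (norm_nonneg w)
  have hy := rpow_third_pow_three hw
  have hxy : w.re ^ (1 / 3 : ℝ) ≤ ‖w‖ ^ (1 / 3 : ℝ) :=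
    Real.rpow_le_rpow hw (Complex.re_le_norm w) (by norm_num)
  have hx0 : 0 ≤ ‖w‖ ^ (1 / 3 : ℝ) := by positivity
  have hy0 : 0 ≤ w.re ^ (1 / 3 : ℝ) := by positivity
  set x := ‖w‖ ^ (1 / 3 : ℝ)
  set y := w.re ^ (1 / 3 : ℝ)
  have h2 : x ^ 2 ≤ 2 * Λ * y := by
    refine le_of_pow_le_pow_left₀ (n := 3) (by norm_num) (by positivity) ?_
    rw [← hx, ← hy] at h
    have : 0 ≤ Λ ^ 3 * y ^ 3 := by positivity
    nlinarith
  have h1 : x ≤ 2 * Λ := by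
    rcases hx0.eq_or_lt with h0 | h0
    · rw [← h0]; positivity
    · nlinarith
  exact ⟨h1, h2, hxy.trans h1⟩

theorem riemannConst_nonneg {a : ℝ} (ha : 0 < a) (ha' : a < 1) : 0 ≤ riemannConst a := by
  have hG := neg_gamma_neg_pos ha ha'
  have h2 : 0 < Real.Gamma (1 - a) := Real.Gamma_pos_of_pos (by linarith)
  unfold riemannConst; positivity

theorem minConst_nonneg {a : ℝ} (ha : 0 < a) (ha' : a < 1) : 0 ≤ minConst a := by
  have hG := neg_gamma_neg_pos ha ha'
  have := riemannConst_nonneg ha ha'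
  unfold minConst; positivity

section

variable {m Λ : ℝ} {w : ℂ}

/-- The error of the approximation of the mean `laplaceSum (1 / 3) m w` is unbounded near the
imaginary axis, but a factor `w.re ^ (1 / 3)` makes up for it. -/
theorem norm_laplaceSum_third_sub_mul_le (hm : 1 ≤ m) (hΛ : 0 < Λ) (hw : 0 ≤ w.re)
    (h : ‖w‖ ^ 2 ≤ 4 * Λ ^ 3 * w.re) :
    ‖laplaceSum (1 / 3) m w - m * (Real.Gamma (-(1 / 3)) : ℂ) * w ^ ((1 / 3 : ℝ) : ℂ)‖
      * w.re ^ (1 / 3 : ℝ) ≤ 4 * riemannConst (1 / 3) * Λ ^ 2 := by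
  have h1 := norm_laplaceSum_sub_le (a := 1 / 3) (m := m) (by norm_num) (by norm_num)
    (by linarith) hw h
  obtain ⟨hb1, hb2, -⟩ := cube_root_bounds hΛ hw h
  have hc := riemannConst_nonneg (a := 1 / 3) (by norm_num) (by norm_num)
  rcases hw.eq_or_lt with h0 | h0
  · rw [← h0, Real.zero_rpow (by norm_num), mul_zero]; positivity
  have hy : 0 < w.re ^ (1 / 3 : ℝ) := by positivity
  have hx0 : 0 ≤ ‖w‖ ^ (1 / 3 : ℝ) := by positivity
  have e : w.re ^ (1 / 3 - 1 : ℝ) * w.re ^ (1 / 3 : ℝ) = (w.re ^ (1 / 3 : ℝ))⁻¹ := by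
    rw [← Real.rpow_neg hw, ← Real.rpow_add h0]; norm_num
  calc _ ≤ riemannConst (1 / 3) * (‖w‖ * w.re ^ (1 / 3 - 1 : ℝ)) * w.re ^ (1 / 3 : ℝ) := by gcongr
    _ = riemannConst (1 / 3) * (‖w‖ * (w.re ^ (1 / 3 : ℝ))⁻¹) := by rw [← e]; ring
    _ = riemannConst (1 / 3)
          * (‖w‖ ^ (1 / 3 : ℝ) * ((‖w‖ ^ (1 / 3 : ℝ)) ^ 2 / w.re ^ (1 / 3 : ℝ))) := by
        nth_rw 1 [← rpow_third_pow_three (norm_nonneg w)]; ring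
    _ ≤ riemannConst (1 / 3) * ((2 * Λ) * (2 * Λ)) := by
        gcongr
        rwa [div_le_iff₀ hy]
    _ = _ := by ring

theorem norm_laplaceSum_two_thirds_sub_le (hm : 1 ≤ m) (hΛ : 0 < Λ) (hw : 0 ≤ w.re)
    (h : ‖w‖ ^ 2 ≤ 4 * Λ ^ 3 * w.re) :
    ‖laplaceSum (2 / 3) m w - m * (Real.Gamma (-(2 / 3)) : ℂ) * w ^ ((2 / 3 : ℝ) : ℂ)‖
      ≤ 4 * riemannConst (2 / 3) * Λ ^ 2 := by
  have h1 := norm_laplaceSum_sub_le (a := 2 / 3) (m := m) (by norm_num) (by norm_num)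
    (by linarith) hw h
  obtain ⟨hb1, hb2, -⟩ := cube_root_bounds hΛ hw h
  have hc := riemannConst_nonneg (a := 2 / 3) (by norm_num) (by norm_num)
  refine h1.trans ?_
  rcases hw.eq_or_lt with h0 | h0
  · rw [← h0, Real.zero_rpow (by norm_num), mul_zero, mul_zero]; positivity
  have hy : 0 < w.re ^ (1 / 3 : ℝ) := by positivity
  have hx0 : 0 ≤ ‖w‖ ^ (1 / 3 : ℝ) := by positivity
  have e : w.re ^ (2 / 3 - 1 : ℝ) = (w.re ^ (1 / 3 : ℝ))⁻¹ := by
    rw [← Real.rpow_neg hw]; norm_num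
  calc _ = riemannConst (2 / 3)
          * (‖w‖ ^ (1 / 3 : ℝ) * ((‖w‖ ^ (1 / 3 : ℝ)) ^ 2 / w.re ^ (1 / 3 : ℝ))) := by
        rw [e]; nth_rw 1 [← rpow_third_pow_three (norm_nonneg w)]; ring
    _ ≤ riemannConst (2 / 3) * ((2 * Λ) * (2 * Λ)) := by
        gcongr
        rwa [div_le_iff₀ hy]
    _ = _ := by ring

end

/-- Replacing the means `α, β` and the covariance `B` by approximations in the leading term of
`(αβ + B)³ - (αβ)³`, when the errors of `α` and `β` are only controlled after multiplication
by `B`. -/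
theorem norm_cube_sub_cube_sub_le {α β B α₀ β₀ B₀ : ℂ} {K m Λ : ℝ} (hm : 1 ≤ m) (hK : 0 ≤ K)
    (hΛ : 0 ≤ Λ)
    (hα : ‖α‖ ≤ K * m * Λ) (hβ : ‖β‖ ≤ K * m * Λ) (hα₀ : ‖α₀‖ ≤ K * m * Λ)
    (hβ₀ : ‖β₀‖ ≤ K * m * Λ) (hB : ‖B‖ ≤ K * m * Λ ^ 2) (hB₀ : ‖B - B₀‖ ≤ K * Λ ^ 2)
    (hαB : ‖α - α₀‖ * ‖B‖ ≤ K * m * Λ ^ 3) (hβB : ‖β - β₀‖ * ‖B‖ ≤ K * m * Λ ^ 3) :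
    ‖(α * β + B) ^ 3 - (α * β) ^ 3 - 3 * (α₀ * β₀) ^ 2 * B₀‖
      ≤ (3 * K ^ 5 + 15 * K ^ 4 + K ^ 3) * (m ^ 4 * Λ ^ 6) := by
  have hm0 : 0 ≤ m := by linarith
  have e : (α * β + B) ^ 3 - (α * β) ^ 3 - 3 * (α₀ * β₀) ^ 2 * B₀
      = 3 * (((α - α₀) * B) * (α + α₀) * β ^ 2 + α₀ ^ 2 * ((β - β₀) * B) * (β + β₀)
        + α₀ ^ 2 * β₀ ^ 2 * (B - B₀)) + 3 * (α * β * B ^ 2) + B ^ 3 := by ring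
  have t1 : ‖((α - α₀) * B) * (α + α₀) * β ^ 2‖ ≤ 2 * K ^ 4 * (m ^ 4 * Λ ^ 6) := by
    rw [norm_mul, norm_mul, norm_mul, norm_pow]
    calc _ ≤ (K * m * Λ ^ 3) * (K * m * Λ + K * m * Λ) * (K * m * Λ) ^ 2 := by
          gcongr; exact (norm_add_le _ _).trans (by gcongr)
      _ = _ := by ring
  have t2 : ‖α₀ ^ 2 * ((β - β₀) * B) * (β + β₀)‖ ≤ 2 * K ^ 4 * (m ^ 4 * Λ ^ 6) := by
    rw [norm_mul, norm_mul, norm_mul, norm_pow]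
    calc _ ≤ (K * m * Λ) ^ 2 * (K * m * Λ ^ 3) * (K * m * Λ + K * m * Λ) := by
          gcongr; exact (norm_add_le _ _).trans (by gcongr)
      _ = _ := by ring
  have t3 : ‖α₀ ^ 2 * β₀ ^ 2 * (B - B₀)‖ ≤ K ^ 5 * (m ^ 4 * Λ ^ 6) := by
    rw [norm_mul, norm_mul, norm_pow, norm_pow]
    calc _ ≤ (K * m * Λ) ^ 2 * (K * m * Λ) ^ 2 * (K * Λ ^ 2) := by gcongr
      _ = _ := by ring
  have t4 : ‖α * β * B ^ 2‖ ≤ K ^ 4 * (m ^ 4 * Λ ^ 6) := by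
    rw [norm_mul, norm_mul, norm_pow]
    calc _ ≤ (K * m * Λ) * (K * m * Λ) * (K * m * Λ ^ 2) ^ 2 := by gcongr
      _ = _ := by ring
  have t5 : ‖B ^ 3‖ ≤ K ^ 3 * (m ^ 4 * Λ ^ 6) := by
    rw [norm_pow]
    calc _ ≤ (K * m * Λ ^ 2) ^ 3 := by gcongr
      _ = K ^ 3 * (m ^ 3 * Λ ^ 6) := by ring
      _ ≤ _ := by gcongr; norm_num
  rw [e]
  have h3 : ‖(3 : ℂ)‖ = 3 := by norm_num
  set T := ((α - α₀) * B) * (α + α₀) * β ^ 2 + α₀ ^ 2 * ((β - β₀) * B) * (β + β₀)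
    + α₀ ^ 2 * β₀ ^ 2 * (B - B₀) with hT
  have n1 := norm_add_le (3 * T + 3 * (α * β * B ^ 2)) (B ^ 3)
  have n2 := norm_add_le (3 * T) (3 * (α * β * B ^ 2))
  rw [norm_mul 3, norm_mul 3, h3] at n2
  have n3 := norm_add₃_le (a := ((α - α₀) * B) * (α + α₀) * β ^ 2)
    (b := α₀ ^ 2 * ((β - β₀) * B) * (β + β₀)) (c := α₀ ^ 2 * β₀ ^ 2 * (B - B₀))
  rw [← hT] at n3
  linarith

/-- A constant that dominates all constants in the estimates of the means and the covariance. -/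
def covConst : ℝ :=
  2 * minConst (1 / 3) + 2 * |Real.Gamma (-(1 / 3))| + 8 * minConst (2 / 3)
    + 8 * riemannConst (2 / 3) + 16 * riemannConst (1 / 3) * minConst (2 / 3)

/-- The covariance of the normalized products of three aggregations at two characters, in terms of
the exponents `ψ`, `ψ'` and `δ` of the two characters and of their quotient. If the aggregations
have means `α`, `β` and covariance `B`, the covariance of the products is `(αβ + B)³ - (αβ)³`, with
leading term `3 (αβ)² B`. The errors of `α` and `β` may be large, but they are multiplied by `B`,
which is small where they are large since `‖δ - (ψ + ψ')‖` is bounded by the geometric mean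
of the real parts. -/
theorem exists_norm_covariance_sub_le : ∃ C : ℝ, 0 ≤ C ∧
    ∀ (lam m : ℝ) (ψ ψ' δ : ℂ), 0 < lam → 1 ≤ m →
      0 ≤ ψ.re → ‖ψ‖ ^ 2 ≤ 2 * ψ.re → 0 ≤ ψ'.re → ‖ψ'‖ ^ 2 ≤ 2 * ψ'.re →
      0 ≤ δ.re → ‖δ‖ ^ 2 ≤ 2 * δ.re → ‖δ - (ψ + ψ')‖ ^ 2 ≤ 4 * (ψ.re * ψ'.re) →
      ‖((laplaceSum (1 / 3) m (lam * ψ) * laplaceSum (1 / 3) m (lam * ψ')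
            + (laplaceSum (2 / 3) m (lam * δ) - laplaceSum (2 / 3) m (lam * (ψ + ψ')))) ^ 3
          - (laplaceSum (1 / 3) m (lam * ψ) * laplaceSum (1 / 3) m (lam * ψ')) ^ 3)
          / (((m ^ 3 * |Real.Gamma (-1 / 3)| ^ 3 : ℝ) : ℂ)) ^ 2
        - 3 * (m : ℂ)⁻¹ * (lam : ℂ) ^ 2 * (Real.Gamma (-2 / 3) : ℂ)
          * ((Real.Gamma (-1 / 3) : ℂ) ^ 2)⁻¹
          * ((δ ^ (2 / 3 : ℂ) - (ψ + ψ') ^ (2 / 3 : ℂ)) * ψ ^ (2 / 3 : ℂ) * ψ' ^ (2 / 3 : ℂ))‖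
      ≤ C * lam ^ 2 / m ^ 2 := by
  have hr1 := riemannConst_nonneg (a := 1 / 3) (by norm_num) (by norm_num)
  have hr2 := riemannConst_nonneg (a := 2 / 3) (by norm_num) (by norm_num)
  have hm1 := minConst_nonneg (a := 1 / 3) (by norm_num) (by norm_num)
  have hm2 := minConst_nonneg (a := 2 / 3) (by norm_num) (by norm_num)
  have hg0 := abs_nonneg (Real.Gamma (-(1 / 3)))
  have hrm : 0 ≤ riemannConst (1 / 3) * minConst (2 / 3) := by positivity
  have hK : 0 ≤ covConst := by unfold covConst; linarith
  have hg : 0 < |Real.Gamma (-(1 / 3))| :=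
    abs_pos.2 (by have := neg_gamma_neg_pos (a := 1 / 3) (by norm_num) (by norm_num); linarith)
  refine ⟨(3 * covConst ^ 5 + 15 * covConst ^ 4 + covConst ^ 3) / |Real.Gamma (-(1 / 3))| ^ 6,
    by positivity, ?_⟩
  intro lam m ψ ψ' δ hlam hm hψ hψ2 hψ' hψ2' hδ hδ2 hd
  have hm0 : 0 < m := by linarith
  -- the natural scale is the cube root of `lam`
  obtain ⟨Λ, hΛ, rfl⟩ : ∃ Λ : ℝ, 0 < Λ ∧ Λ ^ 3 = lam :=
    ⟨lam ^ (1 / 3 : ℝ), by positivity, rpow_third_pow_three hlam.le⟩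
  have scale : ∀ {v : ℂ} {c : ℝ}, 0 ≤ v.re → c ≤ 4 → ‖v‖ ^ 2 ≤ c * v.re →
      0 ≤ (((Λ ^ 3 : ℝ) : ℂ) * v).re ∧
      ‖((Λ ^ 3 : ℝ) : ℂ) * v‖ ^ 2 ≤ 4 * Λ ^ 3 * (((Λ ^ 3 : ℝ) : ℂ) * v).re := by
    intro v c hv hc h
    rw [Complex.re_ofReal_mul, norm_mul, Complex.norm_real, Real.norm_of_nonneg hlam.le]
    refine ⟨by positivity, ?_⟩
    calc (Λ ^ 3 * ‖v‖) ^ 2 = Λ ^ 6 * ‖v‖ ^ 2 := by ring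
      _ ≤ Λ ^ 6 * (4 * v.re) := by gcongr; nlinarith
      _ = _ := by ring
  obtain ⟨z0, z1⟩ := scale hψ (by norm_num) hψ2
  obtain ⟨z0', z1'⟩ := scale hψ' (by norm_num) hψ2'
  obtain ⟨d0, d1⟩ := scale hδ (by norm_num) hδ2
  have hs : ‖ψ + ψ'‖ ^ 2 ≤ 4 * (ψ + ψ').re := by
    have := norm_add_le ψ ψ'
    have h4 : ‖ψ + ψ'‖ ^ 2 ≤ (‖ψ‖ + ‖ψ'‖) ^ 2 := by gcongr
    rw [Complex.add_re]
    nlinarith [sq_nonneg (‖ψ‖ - ‖ψ'‖)]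
  obtain ⟨s0, s1⟩ := scale (by rw [Complex.add_re]; positivity) le_rfl hs
  set L : ℂ := ((Λ ^ 3 : ℝ) : ℂ) with hL
  obtain ⟨x1, -, y1⟩ := cube_root_bounds hΛ z0 z1
  obtain ⟨x2, -, y2⟩ := cube_root_bounds hΛ z0' z1'
  set α := laplaceSum (1 / 3) m (L * ψ) with hαdef
  set β := laplaceSum (1 / 3) m (L * ψ') with hβdef
  set B := laplaceSum (2 / 3) m (L * δ) - laplaceSum (2 / 3) m (L * (ψ + ψ')) with hBdef
  set α₀ : ℂ := m * (Real.Gamma (-(1 / 3)) : ℂ) * (L * ψ) ^ ((1 / 3 : ℝ) : ℂ) with hα₀def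
  set β₀ : ℂ := m * (Real.Gamma (-(1 / 3)) : ℂ) * (L * ψ') ^ ((1 / 3 : ℝ) : ℂ) with hβ₀def
  set B₀ : ℂ := m * (Real.Gamma (-(2 / 3)) : ℂ) * (L * δ) ^ ((2 / 3 : ℝ) : ℂ)
    - m * (Real.Gamma (-(2 / 3)) : ℂ) * (L * (ψ + ψ')) ^ ((2 / 3 : ℝ) : ℂ) with hB₀def
  have mean : ∀ {w : ℂ}, 0 ≤ w.re → ‖w‖ ^ (1 / 3 : ℝ) ≤ 2 * Λ →
      ‖laplaceSum (1 / 3) m w‖ ≤ covConst * m * Λ := by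
    intro w hw hx
    refine (norm_laplaceSum_le (by norm_num) (by norm_num) hm hw).trans ?_
    calc _ ≤ minConst (1 / 3) * m * (2 * Λ) := by gcongr
      _ = (2 * minConst (1 / 3)) * m * Λ := by ring
      _ ≤ _ := by gcongr; unfold covConst; linarith
  have mean₀ : ∀ {w : ℂ}, ‖w‖ ^ (1 / 3 : ℝ) ≤ 2 * Λ →
      ‖(m : ℂ) * (Real.Gamma (-(1 / 3)) : ℂ) * w ^ ((1 / 3 : ℝ) : ℂ)‖ ≤ covConst * m * Λ := by
    intro w hx
    rw [norm_mul, norm_mul, Complex.norm_cpow_real, Complex.norm_real, Complex.norm_real,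
      Real.norm_of_nonneg hm0.le, Real.norm_eq_abs]
    calc _ ≤ m * |Real.Gamma (-(1 / 3))| * (2 * Λ) := by gcongr
      _ = (2 * |Real.Gamma (-(1 / 3))|) * m * Λ := by ring
      _ ≤ _ := by gcongr; unfold covConst; linarith
  have hB1 : ‖B‖ ≤ 2 * minConst (2 / 3) * m *
      ((L * ψ).re ^ (1 / 3 : ℝ) * (L * ψ').re ^ (1 / 3 : ℝ)) := by
    refine (norm_laplaceSum_sub_laplaceSum_le (by norm_num) (by norm_num) hm d0 s0).trans ?_
    rw [rpow_two_thirds (norm_nonneg _)]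
    have h5 : (‖L * δ - L * (ψ + ψ')‖ ^ (1 / 3 : ℝ)) ^ 2
        ≤ 2 * ((L * ψ).re ^ (1 / 3 : ℝ) * (L * ψ').re ^ (1 / 3 : ℝ)) := by
      refine le_of_pow_le_pow_left₀ (n := 3) (by norm_num) (by positivity) ?_
      rw [← pow_mul, mul_comm 2 3, pow_mul, rpow_third_pow_three (norm_nonneg _), mul_pow, mul_pow,
        rpow_third_pow_three z0, rpow_third_pow_three z0', ← mul_sub, norm_mul, Complex.norm_real,
        Real.norm_of_nonneg hlam.le, Complex.re_ofReal_mul, Complex.re_ofReal_mul]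
      calc _ = Λ ^ 6 * ‖δ - (ψ + ψ')‖ ^ 2 := by ring
        _ ≤ Λ ^ 6 * (4 * (ψ.re * ψ'.re)) := by gcongr
        _ ≤ Λ ^ 6 * (8 * (ψ.re * ψ'.re)) := by gcongr; norm_num
        _ = _ := by ring
    calc _ ≤ minConst (2 / 3) * m
          * (2 * ((L * ψ).re ^ (1 / 3 : ℝ) * (L * ψ').re ^ (1 / 3 : ℝ))) := by
          gcongr
      _ = _ := by ring
  have e1 := norm_laplaceSum_third_sub_mul_le hm hΛ z0 z1
  have e2 := norm_laplaceSum_third_sub_mul_le hm hΛ z0' z1'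
  have key := norm_cube_sub_cube_sub_le (α := α) (β := β) (B := B) (α₀ := α₀) (β₀ := β₀) (B₀ := B₀)
    hm hK hΛ.le (mean z0 x1) (mean z0' x2) (mean₀ x1) (mean₀ x2) ?_ ?_ ?_ ?_
  rotate_left
  · refine hB1.trans ?_
    calc _ ≤ 2 * minConst (2 / 3) * m * ((2 * Λ) * (2 * Λ)) := by gcongr
      _ = (8 * minConst (2 / 3)) * m * Λ ^ 2 := by ring
      _ ≤ _ := by gcongr; unfold covConst; linarith
  · have b1 := norm_laplaceSum_two_thirds_sub_le hm hΛ d0 d1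
    have b2 := norm_laplaceSum_two_thirds_sub_le hm hΛ s0 s1
    have e : B - B₀ = (laplaceSum (2 / 3) m (L * δ)
        - m * (Real.Gamma (-(2 / 3)) : ℂ) * (L * δ) ^ ((2 / 3 : ℝ) : ℂ))
        - (laplaceSum (2 / 3) m (L * (ψ + ψ'))
        - m * (Real.Gamma (-(2 / 3)) : ℂ) * (L * (ψ + ψ')) ^ ((2 / 3 : ℝ) : ℂ)) := by
      rw [hBdef, hB₀def]; ring
    rw [e]
    refine (norm_sub_le _ _).trans ((add_le_add b1 b2).trans ?_)
    rw [← add_mul]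
    gcongr; unfold covConst; linarith
  · calc _ ≤ ‖α - α₀‖ * (2 * minConst (2 / 3) * m *
          ((L * ψ).re ^ (1 / 3 : ℝ) * (L * ψ').re ^ (1 / 3 : ℝ))) := by gcongr
      _ = 2 * minConst (2 / 3) * m * (‖α - α₀‖ * (L * ψ).re ^ (1 / 3 : ℝ)
          * (L * ψ').re ^ (1 / 3 : ℝ)) := by ring
      _ ≤ 2 * minConst (2 / 3) * m * ((4 * riemannConst (1 / 3) * Λ ^ 2) * (2 * Λ)) := by gcongr
      _ = (16 * riemannConst (1 / 3) * minConst (2 / 3)) * m * Λ ^ 3 := by ring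
      _ ≤ _ := by gcongr; unfold covConst; linarith
  · calc _ ≤ ‖β - β₀‖ * (2 * minConst (2 / 3) * m *
          ((L * ψ).re ^ (1 / 3 : ℝ) * (L * ψ').re ^ (1 / 3 : ℝ))) := by gcongr
      _ = 2 * minConst (2 / 3) * m * (‖β - β₀‖ * (L * ψ').re ^ (1 / 3 : ℝ)
          * (L * ψ).re ^ (1 / 3 : ℝ)) := by ring
      _ ≤ 2 * minConst (2 / 3) * m * ((4 * riemannConst (1 / 3) * Λ ^ 2) * (2 * Λ)) := by gcongr
      _ = (16 * riemannConst (1 / 3) * minConst (2 / 3)) * m * Λ ^ 3 := by ring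
      _ ≤ _ := by gcongr; unfold covConst; linarith
  have a1 : α₀ ^ 2 = m ^ 2 * (Real.Gamma (-(1 / 3)) : ℂ) ^ 2 * ((Λ : ℂ) ^ 2 * ψ ^ (2 / 3 : ℂ)) := by
    rw [hα₀def, mul_pow, ofReal_pow_three_mul_cpow_third_sq hΛ]; ring
  have a2 : β₀ ^ 2 = m ^ 2 * (Real.Gamma (-(1 / 3)) : ℂ) ^ 2
      * ((Λ : ℂ) ^ 2 * ψ' ^ (2 / 3 : ℂ)) := by
    rw [hβ₀def, mul_pow, ofReal_pow_three_mul_cpow_third_sq hΛ]; ring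
  have a3 : B₀ = m * (Real.Gamma (-(2 / 3)) : ℂ) * (Λ : ℂ) ^ 2 *
      (δ ^ (2 / 3 : ℂ) - (ψ + ψ') ^ (2 / 3 : ℂ)) := by
    rw [hB₀def, ofReal_pow_three_mul_cpow_two_thirds hΛ, ofReal_pow_three_mul_cpow_two_thirds hΛ]
    ring
  have g1 : (-1 / 3 : ℝ) = -(1 / 3) := by norm_num
  have g2 : (-2 / 3 : ℝ) = -(2 / 3) := by norm_num
  rw [g1, g2]
  set g := Real.Gamma (-(1 / 3)) with hgdef
  have hgc : (g : ℂ) ≠ 0 := by exact_mod_cast abs_pos.1 hg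
  have hmc : (m : ℂ) ≠ 0 := by exact_mod_cast hm0.ne'
  have hden : (((m ^ 3 * |g| ^ 3 : ℝ) : ℂ)) ^ 2 = (m : ℂ) ^ 6 * (g : ℂ) ^ 6 := by
    have : (m ^ 3 * |g| ^ 3) ^ 2 = m ^ 6 * g ^ 6 := by
      have h6 : |g| ^ 6 = g ^ 6 := by
        rw [show 6 = 2 * 3 from rfl, pow_mul, pow_mul, sq_abs]
      calc _ = m ^ 6 * |g| ^ 6 := by ring
        _ = _ := by rw [h6]
    rw [← Complex.ofReal_pow, this]; push_cast; ring
  have hfin : 3 * (m : ℂ)⁻¹ * (L : ℂ) ^ 2 * (Real.Gamma (-(2 / 3)) : ℂ) * ((g : ℂ) ^ 2)⁻¹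
      * ((δ ^ (2 / 3 : ℂ) - (ψ + ψ') ^ (2 / 3 : ℂ)) * ψ ^ (2 / 3 : ℂ) * ψ' ^ (2 / 3 : ℂ))
      = 3 * (α₀ * β₀) ^ 2 * B₀ / ((m : ℂ) ^ 6 * (g : ℂ) ^ 6) := by
    rw [mul_pow α₀, a1, a2, a3, hL]
    push_cast
    field_simp
  rw [hden, hfin, ← sub_div, norm_div]
  have hdn : ‖(m : ℂ) ^ 6 * (g : ℂ) ^ 6‖ = m ^ 6 * |g| ^ 6 := by
    rw [norm_mul, norm_pow, norm_pow, Complex.norm_real, Complex.norm_real,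
      Real.norm_of_nonneg hm0.le, Real.norm_eq_abs]
  rw [hdn, div_le_iff₀ (by positivity)]
  refine key.trans (le_of_eq ?_)
  field_simp

/-! ### Characters -/

section Pairing

variable {G : Type*} [AddCommGroup G] [TopologicalSpace G]

@[simp]
theorem pairing_zero (γ : Dual G) : pairing (0 : G) γ = 1 := by
  simp [pairing]

theorem pairing_add (x y : G) (γ : Dual G) : pairing (x + y) γ = pairing x γ * pairing y γ := by
  simp [pairing, ofAdd_add, map_mul]

@[simp]
theorem norm_pairing (x : G) (γ : Dual G) : ‖pairing x γ‖ = 1 := Circle.norm_coe _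

theorem pairing_inv (x : G) (γ : Dual G) : pairing x γ⁻¹ = starRingEnd ℂ (pairing x γ) := by
  have : (γ⁻¹) (Multiplicative.ofAdd x) = (γ (Multiplicative.ofAdd x))⁻¹ := rfl
  rw [pairing, pairing, this, Circle.coe_inv_eq_conj]

theorem pairing_mul (x : G) (γ γ' : Dual G) :
    pairing x (γ * γ') = pairing x γ * pairing x γ' := by
  have : (γ * γ') (Multiplicative.ofAdd x)
      = γ (Multiplicative.ofAdd x) * γ' (Multiplicative.ofAdd x) := rfl
  simp [pairing, this]

theorem pairing_mul_inv (x : G) (γ γ' : Dual G) :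
    pairing x (γ * γ'⁻¹) = pairing x γ * starRingEnd ℂ (pairing x γ') := by
  rw [pairing_mul, pairing_inv]

theorem continuous_pairing (γ : Dual G) : Continuous fun x : G => pairing x γ := by
  unfold pairing
  have h : Continuous fun y : Multiplicative G => γ y := ContinuousMonoidHom.continuous_toFun γ
  exact continuous_subtype_val.comp (h.comp continuous_ofAdd)

theorem continuous_pairing_right (x : G) : Continuous fun γ : Dual G => pairing x γ := by
  unfold pairing
  have h : Continuous fun γ : Dual G => γ (Multiplicative.ofAdd x) :=
    (continuous_eval_const (F := C(Multiplicative G, Circle)) (Multiplicative.ofAdd x)).comp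
      (ContinuousMonoidHom.isInducing_toContinuousMap (Multiplicative G) Circle).continuous
  exact continuous_subtype_val.comp h

theorem continuous_uncurry_pairing [LocallyCompactSpace G] :
    Continuous fun p : G × Dual G => pairing p.1 p.2 := by
  unfold pairing
  have : LocallyCompactSpace (Multiplicative G) := inferInstance
  have h : Continuous fun p : G × Dual G => p.2 (Multiplicative.ofAdd p.1) := by
    have h1 : Continuous fun p : C(Multiplicative G, Circle) × Multiplicative G => p.1 p.2 :=
      continuous_eval
    exact h1.comp ((((ContinuousMonoidHom.isInducing_toContinuousMap
      (Multiplicative G) Circle).continuous).comp continuous_snd).prodMk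
        (continuous_ofAdd.comp continuous_fst))
  exact continuous_subtype_val.comp h

end Pairing

/-! ### Integration against a mixture of probability measures -/

/-- Integration against a mixture of an a.e. measurable family of probability measures; the family
is replaced by a Markov kernel that agrees with it almost everywhere. -/
theorem integral_bind_of_aemeasurable {α β : Type*} [MeasurableSpace α] [MeasurableSpace β]
    [Nonempty β] {μ : Measure α} [IsProbabilityMeasure μ] {κ : α → Measure β}
    (hκ : AEMeasurable κ μ) (hp : ∀ᵐ a ∂μ, IsProbabilityMeasure (κ a)) {f : β → ℂ}
    (hf : Measurable f) {C : ℝ} (hC : ∀ b, ‖f b‖ ≤ C) :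
    ∫ b, f b ∂(μ.bind κ) = ∫ a, ∫ b, f b ∂(κ a) ∂μ := by
  classical
  obtain ⟨b₀⟩ := ‹Nonempty β›
  let S : Set α := {a | hκ.mk κ a univ = 1}
  have hS : MeasurableSet S :=
    (Measure.measurable_coe MeasurableSet.univ).comp hκ.measurable_mk (measurableSet_singleton 1)
  let κ' : Kernel α β := ⟨S.piecewise (hκ.mk κ) (fun _ => Measure.dirac b₀),
    hκ.measurable_mk.piecewise hS measurable_const⟩
  have hκ'p : ∀ a, IsProbabilityMeasure (κ' a) := by
    intro a
    by_cases ha : a ∈ S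
    · exact ⟨by simp only [κ', Kernel.coe_mk, piecewise_eq_of_mem _ _ _ ha]; exact ha⟩
    · simp only [κ', Kernel.coe_mk, piecewise_eq_of_notMem _ _ _ ha]; infer_instance
  have : IsMarkovKernel κ' := ⟨hκ'p⟩
  have hae : κ =ᵐ[μ] κ' := by
    filter_upwards [hκ.ae_eq_mk, hp] with a ha hpa
    have : a ∈ S := by
      change hκ.mk κ a univ = 1
      rw [← ha]; exact hpa.measure_univ
    simp only [κ', Kernel.coe_mk, piecewise_eq_of_mem _ _ _ this, ha]
  rw [Measure.bind_congr_right hae, ← Measure.snd_compProd, Measure.snd,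
    integral_map measurable_snd.aemeasurable hf.aestronglyMeasurable, Measure.integral_compProd]
  · exact integral_congr_ae (hae.mono fun a ha => by simp only [ha])
  · exact Integrable.of_bound (hf.comp measurable_snd).aestronglyMeasurable C
      (Eventually.of_forall fun p => hC _)

/-! ### Convolution powers and compound Poisson laws -/

section Laws

variable {G : Type*} [AddCommGroup G] [MeasurableSpace G] {μ : Measure G}

theorem measurable_sumLaw (μ : Measure G) : Measurable (sumLaw μ) := measurable_from_top

theorem compoundPoisson_apply (t : ℝ) (μ : Measure G) {B : Set G} (hB : MeasurableSet B) :
    compoundPoisson t μ B = ∫⁻ n, sumLaw μ n B ∂(poissonMeasure t.toNNReal) :=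
  Measure.bind_apply hB (measurable_sumLaw μ).aemeasurable

theorem sumLaw_univ_le [IsProbabilityMeasure μ] (n : ℕ) : sumLaw μ n univ ≤ 1 := by
  induction n with
  | zero => simp [sumLaw]
  | succ n ih =>
    refine (Measure.bind_apply_le _ .univ).trans ?_
    calc _ ≤ ∫⁻ _, 1 ∂μ := by
          refine lintegral_mono fun x => ?_
          by_cases h : AEMeasurable (fun y => x + y) (sumLaw μ n)
          · rw [Measure.map_apply_of_aemeasurable h .univ]; simpa using ih
          · simp [Measure.map_of_not_aemeasurable h]
      _ = 1 := by simp

theorem ae_poissonMeasure_iff {r : ℝ≥0} (hr : 0 < r) {p : ℕ → Prop} :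
    (∀ᵐ n ∂(poissonMeasure r), p n) ↔ ∀ n, p n := by
  refine ⟨fun h n => ?_, fun h => Eventually.of_forall h⟩
  by_contra hn
  have h0 : poissonMeasure r {n} = 0 := measure_mono_null (by simpa using hn) (ae_iff.1 h)
  have := poissonMeasure_real_singleton_pos n hr
  rw [measureReal_def, h0] at this
  simp at this

/-- If a compound Poisson law has total mass one, so do all the convolution powers: none of them has
larger mass, and each enters with positive weight. As a mixture of a family that is not a.e.
measurable is the zero measure, this contains the measurability of the mixtures in `sumLaw`. -/
theorem isProbabilityMeasure_sumLaw [IsProbabilityMeasure μ] {t : ℝ} (ht : 0 < t)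
    [h : IsProbabilityMeasure (compoundPoisson t μ)] (n : ℕ) :
    IsProbabilityMeasure (sumLaw μ n) := by
  have h1 := h.measure_univ
  rw [compoundPoisson_apply t μ .univ] at h1
  have h2 : (fun n => sumLaw μ n univ) =ᵐ[poissonMeasure t.toNNReal] fun _ => 1 :=
    ae_eq_of_ae_le_of_lintegral_le (Eventually.of_forall sumLaw_univ_le) (by rw [h1]; simp)
      aemeasurable_const (by rw [h1]; simp)
  exact ⟨(ae_poissonMeasure_iff (Real.toNNReal_pos.2 ht)).1 h2 n⟩

/-- Measurability of the translates of a convolution power: otherwise the next power would be the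
zero measure. -/
theorem aemeasurable_map_add_sumLaw [IsProbabilityMeasure μ] {t : ℝ} (ht : 0 < t)
    [IsProbabilityMeasure (compoundPoisson t μ)] (n : ℕ) :
    AEMeasurable (fun x => (sumLaw μ n).map fun y => x + y) μ := by
  by_contra hn
  have h := (isProbabilityMeasure_sumLaw (μ := μ) ht (n + 1)).measure_univ
  simp only [sumLaw, Measure.bind, Measure.map_of_not_aemeasurable hn, Measure.join_zero] at h
  simp at h

/-- A Poisson sum of mean `t` is empty with probability `exp (-t) ≥ 1 - t`. -/
theorem compoundPoisson_compl_zero_le [MeasurableSingletonClass G] [IsProbabilityMeasure μ] {t : ℝ}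
    (ht : 0 ≤ t) : compoundPoisson t μ {0}ᶜ ≤ ENNReal.ofReal t := by
  rw [compoundPoisson_apply t μ (measurableSet_singleton 0).compl]
  calc _ ≤ ∫⁻ n, ({0}ᶜ : Set ℕ).indicator 1 n ∂(poissonMeasure t.toNNReal) := by
        refine lintegral_mono fun n => ?_
        rcases n with _ | n
        · simp [sumLaw]
        · simpa using (measure_mono (subset_univ _)).trans (sumLaw_univ_le (n + 1))
    _ = 1 - ENNReal.ofReal (Real.exp (-t)) := by
        rw [lintegral_indicator_one (MeasurableSet.of_discrete), prob_compl_eq_one_sub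
          (MeasurableSet.of_discrete), poissonMeasure_singleton]
        simp [Real.coe_toNNReal _ ht]
    _ ≤ _ := by
        rw [← ENNReal.ofReal_one, ← ENNReal.ofReal_sub _ (Real.exp_pos _).le]
        exact ENNReal.ofReal_le_ofReal (by linarith [Real.add_one_le_exp (-t)])

variable [TopologicalSpace G] [BorelSpace G]

theorem measurable_pairing (γ : Dual G) : Measurable fun x : G => pairing x γ :=
  (continuous_pairing γ).measurable

variable [IsTopologicalAddGroup G]

theorem integral_pairing_sumLaw [IsProbabilityMeasure μ] {t : ℝ} (ht : 0 < t)
    [IsProbabilityMeasure (compoundPoisson t μ)] (γ : Dual G) (n : ℕ) :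
    ∫ x, pairing x γ ∂(sumLaw μ n) = (∫ x, pairing x γ ∂μ) ^ n := by
  induction n with
  | zero => simp [sumLaw, integral_dirac' _ _ (measurable_pairing γ).stronglyMeasurable]
  | succ n ih =>
    have := isProbabilityMeasure_sumLaw (μ := μ) ht n
    rw [sumLaw, integral_bind_of_aemeasurable (aemeasurable_map_add_sumLaw ht n)
      (Eventually.of_forall fun x =>
        Measure.isProbabilityMeasure_map (measurable_const_add x).aemeasurable)
      (measurable_pairing γ) (fun b => (norm_pairing b γ).le)]
    have : ∀ x, ∫ b, pairing b γ ∂((sumLaw μ n).map fun y => x + y)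
        = pairing x γ * (∫ x, pairing x γ ∂μ) ^ n := by
      intro x
      rw [integral_map (measurable_const_add x).aemeasurable
        (measurable_pairing γ).aestronglyMeasurable]
      simp_rw [pairing_add]
      rw [integral_const_mul, ih]
    simp_rw [this]
    rw [integral_mul_const, pow_succ, mul_comm]

/-- The characteristic function of a compound Poisson law. -/
theorem integral_pairing_compoundPoisson [IsProbabilityMeasure μ] {t : ℝ} (ht : 0 < t)
    [IsProbabilityMeasure (compoundPoisson t μ)] (γ : Dual G) :
    ∫ x, pairing x γ ∂(compoundPoisson t μ)
      = Complex.exp (-(t * (1 - ∫ x, pairing x γ ∂μ))) := by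
  have hp := isProbabilityMeasure_sumLaw (μ := μ) ht
  rw [compoundPoisson, integral_bind_of_aemeasurable (measurable_sumLaw μ).aemeasurable
    (Eventually.of_forall hp) (measurable_pairing γ) (fun b => (norm_pairing b γ).le)]
  simp_rw [integral_pairing_sumLaw ht]
  set c := ∫ x, pairing x γ ∂μ
  rw [integral_poissonMeasure, Real.coe_toNNReal _ ht.le]
  have e : ∀ n : ℕ, (Real.exp (-t) * t ^ n / (n.factorial : ℝ)) • c ^ n
      = Complex.exp (-t) * ((t * c) ^ n / (n.factorial : ℂ)) := by
    intro n
    rw [Complex.real_smul]; push_cast; ring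
  simp_rw [e]
  have h := NormedSpace.expSeries_div_hasSum_exp ((t : ℂ) * c)
  rw [tsum_mul_left, h.tsum_eq, ← Complex.exp_eq_exp_ℂ, ← Complex.exp_add]
  congr 1; ring

end Laws

/-! ### Concentration on a σ-compact set -/

section SigmaCompact

theorem measurableSet_of_isSigmaCompact {X : Type*} [TopologicalSpace X] [T2Space X]
    [MeasurableSpace X] [BorelSpace X] {s : Set X} (hs : IsSigmaCompact s) : MeasurableSet s := by
  obtain ⟨K, hK, rfl⟩ := hs
  exact MeasurableSet.iUnion fun n => (hK n).measurableSet

/-- A measurable set of finite measure is contained in a σ-compact set, up to a null set. -/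
theorem exists_isSigmaCompact_measure_diff_eq_zero {X : Type*} [TopologicalSpace X] [T2Space X]
    [MeasurableSpace X] [BorelSpace X] (μ : Measure X) [μ.InnerRegularCompactLTTop] {s : Set X}
    (hs : MeasurableSet s) (h : μ s ≠ ∞) : ∃ K, IsSigmaCompact K ∧ μ (s \ K) = 0 := by
  have h1 : ∀ n : ℕ, ∃ K ⊆ s, IsCompact K ∧ μ (s \ K) < ((n : ℝ≥0∞) + 1)⁻¹ := fun n =>
    hs.exists_isCompact_sdiff_lt h (by simp)
  choose K hKs hK hKn using h1
  refine ⟨⋃ n, K n, isSigmaCompact_iUnion_of_isCompact K hK, ?_⟩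
  refine le_antisymm (ENNReal.le_of_forall_pos_le_add fun ε hε _ => ?_) bot_le
  obtain ⟨n, hn⟩ := ENNReal.exists_inv_nat_lt (a := (ε : ℝ≥0∞)) (by simpa using hε.ne')
  rw [zero_add]
  calc μ (s \ ⋃ n, K n) ≤ μ (s \ K n) := measure_mono (sdiff_subset_sdiff_right (subset_iUnion K n))
    _ ≤ ((n : ℝ≥0∞) + 1)⁻¹ := (hKn n).le
    _ ≤ (n : ℝ≥0∞)⁻¹ := ENNReal.inv_le_inv.2 le_self_add
    _ ≤ ε := hn.le

/-- The sums of `n` elements of `K`. -/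
def sumSet {G : Type*} [AddCommGroup G] (K : Set G) : ℕ → Set G
  | 0 => {0}
  | n + 1 => image2 (· + ·) K (sumSet K n)

variable {G : Type*} [AddCommGroup G] [TopologicalSpace G] [IsTopologicalAddGroup G]

theorem isSigmaCompact_sumSet {K : Set G} (hK : IsSigmaCompact K) (n : ℕ) :
    IsSigmaCompact (sumSet K n) := by
  induction n with
  | zero => exact isCompact_singleton.isSigmaCompact
  | succ n ih =>
    obtain ⟨A, hA, rfl⟩ := hK
    obtain ⟨B, hB, hBe⟩ := ih
    rw [sumSet, ← hBe, image2_iUnion_left]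
    simp_rw [image2_iUnion_right]
    refine isSigmaCompact_iUnion _ fun i => isSigmaCompact_iUnion_of_isCompact _ fun j => ?_
    rw [← image_prod]
    exact ((hA i).prod (hB j)).image continuous_add

variable [T2Space G] [MeasurableSpace G] [BorelSpace G] {μ : Measure G}

theorem sumLaw_compl_sumSet {K : Set G} (hK : IsSigmaCompact K) (hμ : μ Kᶜ = 0) (n : ℕ) :
    sumLaw μ n (sumSet K n)ᶜ = 0 := by
  induction n with
  | zero => simp [sumLaw, sumSet]
  | succ n ih =>
    have hmeas := (measurableSet_of_isSigmaCompact (isSigmaCompact_sumSet hK (n + 1))).compl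
    have h0 : (fun x => (Measure.map (fun y => x + y) (sumLaw μ n)) (sumSet K (n + 1))ᶜ)
        =ᵐ[μ] 0 := by
      filter_upwards [compl_mem_ae_iff.2 hμ] with x hx
      rw [compl_compl] at hx
      rw [Measure.map_apply (measurable_const_add x) hmeas]
      exact measure_mono_null
        (fun y (hy : x + y ∉ _) (hyn : y ∈ sumSet K n) => hy (mem_image2_of_mem hx hyn)) ih
    refine le_antisymm ((Measure.bind_apply_le _ hmeas).trans (le_of_eq ?_)) bot_le
    rw [lintegral_congr_ae h0]
    simp

/-- All compound Poisson laws built from a regular law live on a common σ-compact set. -/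
theorem exists_isSigmaCompact_compoundPoisson_compl [IsProbabilityMeasure μ] [μ.Regular] :
    ∃ S : Set G, IsSigmaCompact S ∧ μ Sᶜ = 0 ∧ ∀ t, compoundPoisson t μ Sᶜ = 0 := by
  obtain ⟨K, hK, h⟩ := exists_isSigmaCompact_measure_diff_eq_zero μ MeasurableSet.univ (by simp)
  rw [← compl_eq_univ_sdiff] at h
  have hsub : ∀ n, sumSet K n ⊆ K ∪ ⋃ n, sumSet K n := fun n =>
    (subset_iUnion _ n).trans subset_union_right
  have hS : IsSigmaCompact (K ∪ ⋃ n, sumSet K n) := by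
    rw [union_eq_iUnion]
    refine isSigmaCompact_iUnion _ fun b => ?_
    cases b
    · exact isSigmaCompact_iUnion _ (isSigmaCompact_sumSet hK)
    · exact hK
  refine ⟨_, hS, measure_mono_null (compl_subset_compl.2 subset_union_left) h, fun t => ?_⟩
  rw [compoundPoisson_apply t μ (measurableSet_of_isSigmaCompact hS).compl]
  have : ∀ n, sumLaw μ n (K ∪ ⋃ n, sumSet K n)ᶜ = 0 := fun n =>
    measure_mono_null (compl_subset_compl.2 (hsub n)) (sumLaw_compl_sumSet hK h n)
  simp only [this, lintegral_const, zero_mul]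

end SigmaCompact

/-! ### Joint measurability of the pairing -/

section Joint

variable {X Y : Type*} [TopologicalSpace X] [T2Space X] [LocallyCompactSpace X]
  [MeasurableSpace X] [BorelSpace X] [TopologicalSpace Y] [T2Space Y] [LocallyCompactSpace Y]
  [MeasurableSpace Y] [BorelSpace Y]

/-- On a product of σ-compact sets a jointly continuous function is measurable for the product of
the Borel σ-algebras, although this σ-algebra may be smaller than the Borel σ-algebra of the
product. -/
theorem aestronglyMeasurable_restrict_prod_of_isSigmaCompact {h : X × Y → ℂ} (hh : Continuous h)
    {K : Set X} (hK : IsSigmaCompact K) {L : Set Y} (hL : IsSigmaCompact L)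
    (M : Measure (X × Y)) : AEStronglyMeasurable h (M.restrict (K ×ˢ L)) := by
  obtain ⟨A, hA, rfl⟩ := hK
  obtain ⟨B, hB, rfl⟩ := hL
  rw [iUnion_prod_const]
  simp_rw [prod_iUnion]
  refine aestronglyMeasurable_iUnion_iff.2 fun i => ?_
  refine aestronglyMeasurable_iUnion_iff.2 fun j => ?_
  obtain ⟨f, hf1, -, hfc, -⟩ := exists_continuous_one_zero_of_isCompact ((hA i).prod (hB j))
    isClosed_empty (disjoint_empty _)
  have hm : Measurable fun p : X × Y => (f p : ℂ) * h p := by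
    refine HasCompactSupport.measurable_of_prod (by fun_prop) ?_
    refine HasCompactSupport.mul_right ?_
    exact hfc.comp_left (g := fun r : ℝ => (r : ℂ)) (by simp)
  refine hm.aestronglyMeasurable.congr ?_
  refine (ae_restrict_mem ((hA i).measurableSet.prod (hB j).measurableSet)).mono fun p hp => ?_
  simp [hf1 hp]

end Joint

/-- An integrable function vanishes almost everywhere outside of a σ-compact set. -/
theorem exists_isSigmaCompact_forall_notMem_eq_zero {X : Type*} [TopologicalSpace X] [T2Space X]
    [MeasurableSpace X] [BorelSpace X] {μ : Measure X} [μ.InnerRegularCompactLTTop] {f : X → ℂ}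
    (hf : Integrable f μ) : ∃ L, IsSigmaCompact L ∧ ∀ᵐ x ∂μ, x ∉ L → f x = 0 := by
  have hg : Integrable (hf.1.mk f) μ := hf.congr hf.1.ae_eq_mk
  have hgm : StronglyMeasurable (hf.1.mk f) := hf.1.stronglyMeasurable_mk
  have h1 : ∀ n : ℕ, ∃ K, IsSigmaCompact K ∧
      μ ({x | 1 / ((n : ℝ) + 1) ≤ ‖hf.1.mk f x‖} \ K) = 0 := fun n =>
    exists_isSigmaCompact_measure_diff_eq_zero μ
      (measurableSet_le measurable_const hgm.norm.measurable)
      (hg.measure_norm_ge_lt_top (by positivity)).ne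
  choose K hK hK0 using h1
  refine ⟨⋃ n, K n, isSigmaCompact_iUnion K hK, ?_⟩
  filter_upwards [hf.1.ae_eq_mk, ae_all_iff.2 fun n => measure_eq_zero_iff_ae_notMem.1 (hK0 n)]
    with x hx hxn hxL
  rw [hx]
  by_contra h0
  obtain ⟨n, hn⟩ := exists_nat_one_div_lt (norm_pos_iff.2 h0)
  exact hxn n ⟨hn.le, fun h => hxL (mem_iUnion_of_mem n h)⟩

theorem sigmaFinite_restrict_of_isSigmaCompact {X : Type*} [TopologicalSpace X] [T2Space X]
    [MeasurableSpace X] [BorelSpace X] {μ : Measure X} [IsFiniteMeasureOnCompacts μ] {L : Set X}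
    (hL : IsSigmaCompact L) : SigmaFinite (μ.restrict L) := by
  have hLm := measurableSet_of_isSigmaCompact hL
  obtain ⟨K, hK, hKL⟩ := hL
  refine ⟨⟨⟨fun n => K n ∪ Lᶜ, fun _ => trivial, fun n => ?_, ?_⟩⟩⟩
  · rw [Measure.restrict_apply ((hK n).measurableSet.union hLm.compl), union_inter_distrib_right,
      compl_inter_self, union_empty]
    exact (measure_mono inter_subset_left).trans_lt (hK n).measure_lt_top
  · rw [← iUnion_union, hKL, union_compl_self]

section Pairing

variable {G : Type*} [AddCommGroup G] [TopologicalSpace G] [IsTopologicalAddGroup G]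
  [LocallyCompactSpace G] [T2Space G] [MeasurableSpace G] [BorelSpace G]
  [MeasurableSpace (Dual G)] [BorelSpace (Dual G)]

theorem aestronglyMeasurable_pairing {μ : Measure G} [SFinite μ] {ν : Measure (Dual G)}
    [SFinite ν] {K : Set G} (hK : IsSigmaCompact K) (hμ : μ Kᶜ = 0) {L : Set (Dual G)}
    (hL : IsSigmaCompact L) (hν : ν Lᶜ = 0) :
    AEStronglyMeasurable (fun p : G × Dual G => pairing p.1 p.2) (μ.prod ν) := by
  have h1 : μ.restrict K = μ := Measure.restrict_eq_self_of_ae_mem (mem_ae_iff.2 hμ)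
  have h2 : ν.restrict L = ν := Measure.restrict_eq_self_of_ae_mem (mem_ae_iff.2 hν)
  have := aestronglyMeasurable_restrict_prod_of_isSigmaCompact
    (continuous_uncurry_pairing (G := G)) hK hL (μ.prod ν)
  rwa [← Measure.prod_restrict, h1, h2] at this

theorem aestronglyMeasurable_pairing_comp {Ω : Type*} [MeasurableSpace Ω] {P : Measure Ω}
    [SFinite P] {X : Ω → G} (hX : Measurable X) {ν : Measure (Dual G)}
    [SFinite ν] {K : Set G} (hK : IsSigmaCompact K) (hμ : P.map X Kᶜ = 0) {L : Set (Dual G)}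
    (hL : IsSigmaCompact L) (hν : ν Lᶜ = 0) :
    AEStronglyMeasurable (fun p : Ω × Dual G => pairing (X p.1) p.2) (P.prod ν) := by
  have h := aestronglyMeasurable_pairing hK hμ hL hν
  have e : (P.map X).prod ν = (P.prod ν).map (Prod.map X id) := by
    rw [← Measure.map_prod_map P ν hX measurable_id, Measure.map_id]
  rw [e] at h
  exact h.comp_measurable (hX.prodMap measurable_id)

end Pairing

/-! ### The characteristic exponent -/

section Exponent

variable {G : Type*} [AddCommGroup G] [TopologicalSpace G]

theorem norm_one_sub_pairing_sq (x : G) (γ : Dual G) :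
    ‖1 - pairing x γ‖ ^ 2 = 2 * (1 - (pairing x γ).re) := by
  have h : ‖pairing x γ‖ ^ 2 = 1 := by simp
  rw [Complex.sq_norm, Complex.normSq_apply] at h ⊢
  simp only [Complex.sub_re, Complex.sub_im, Complex.one_re, Complex.one_im]
  nlinarith

variable [MeasurableSpace G]

/-- `1 - E (R, γ)`, the characteristic exponent of the compound Poisson process of jump law `μ`. -/
def exponent (μ : Measure G) (γ : Dual G) : ℂ := 1 - ∫ x, pairing x γ ∂μ

theorem conj_ofReal_mul_exponent (μ : Measure G) (lam : ℝ) (γ : Dual G) :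
    starRingEnd ℂ (lam * exponent μ γ) = lam * starRingEnd ℂ (exponent μ γ) := by
  rw [map_mul, Complex.conj_ofReal]

variable {μ : Measure G} [IsProbabilityMeasure μ]

theorem norm_integral_pairing_le (γ : Dual G) : ‖∫ x, pairing x γ ∂μ‖ ≤ 1 := by
  simpa using norm_integral_le_of_norm_le_const (μ := μ)
    (Eventually.of_forall fun x => (norm_pairing x γ).le)

theorem norm_exponent_sq_le (γ : Dual G) : ‖exponent μ γ‖ ^ 2 ≤ 2 * (exponent μ γ).re := by
  have h := norm_integral_pairing_le (μ := μ) γ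
  unfold exponent
  set c := ∫ x, pairing x γ ∂μ
  have h2 : ‖c‖ ^ 2 ≤ 1 := by nlinarith [norm_nonneg c]
  rw [Complex.sq_norm, Complex.normSq_apply] at h2 ⊢
  simp only [Complex.sub_re, Complex.sub_im, Complex.one_re, Complex.one_im]
  nlinarith

theorem exponent_re_nonneg (γ : Dual G) : 0 ≤ (exponent μ γ).re := by
  nlinarith [norm_exponent_sq_le (μ := μ) γ, sq_nonneg ‖exponent μ γ‖]

theorem norm_exponent_le (γ : Dual G) : ‖exponent μ γ‖ ≤ 2 := by
  have := norm_integral_pairing_le (μ := μ) γ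
  refine (norm_sub_le _ _).trans ?_
  simp; linarith

variable [BorelSpace G]

theorem integrable_pairing (γ : Dual G) : Integrable (fun x => pairing x γ) μ :=
  Integrable.of_bound (measurable_pairing γ).aestronglyMeasurable 1
    (Eventually.of_forall fun x => (norm_pairing x γ).le)

theorem integral_norm_one_sub_pairing_sq (γ : Dual G) :
    ∫ x, ‖1 - pairing x γ‖ ^ 2 ∂μ = 2 * (exponent μ γ).re := by
  simp_rw [norm_one_sub_pairing_sq]
  have h := (integrable_pairing (μ := μ) γ)
  have hre : Integrable (fun x => (pairing x γ).re) μ := h.re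
  rw [integral_const_mul, integral_sub (integrable_const _) hre]
  have : ∫ x, (pairing x γ).re ∂μ = (∫ x, pairing x γ ∂μ).re := integral_re h
  simp [exponent, this]

/-- The exponent is additive up to the geometric mean of the real parts, by the Cauchy-Schwarz
inequality for `E (1 - (R, γ)) conj (1 - (R, γ'))`. -/
theorem norm_exponent_mul_inv_sub_sq_le (γ γ' : Dual G) :
    ‖exponent μ (γ * γ'⁻¹) - (exponent μ γ + starRingEnd ℂ (exponent μ γ'))‖ ^ 2
      ≤ 4 * ((exponent μ γ).re * (starRingEnd ℂ (exponent μ γ')).re) := by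
  have h1 := integrable_pairing (μ := μ) γ
  have h2 := integrable_pairing (μ := μ) γ'⁻¹
  have h3 := integrable_pairing (μ := μ) (γ * γ'⁻¹)
  have hconj : starRingEnd ℂ (exponent μ γ') = 1 - ∫ x, pairing x γ'⁻¹ ∂μ := by
    simp_rw [exponent, pairing_inv]
    rw [integral_conj, map_sub, map_one]
  have e : exponent μ (γ * γ'⁻¹) - (exponent μ γ + starRingEnd ℂ (exponent μ γ'))
      = -∫ x, (1 - pairing x γ) * starRingEnd ℂ (1 - pairing x γ') ∂μ := by
    have e1 : ∀ x, (1 - pairing x γ) * starRingEnd ℂ (1 - pairing x γ')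
        = 1 - pairing x γ - pairing x γ'⁻¹ + pairing x (γ * γ'⁻¹) := by
      intro x; rw [pairing_mul_inv, pairing_inv, map_sub, map_one]; ring
    simp_rw [e1]
    have i1 : Integrable (fun x => 1 - pairing x γ) μ := (integrable_const _).sub h1
    have i2 : Integrable (fun x => 1 - pairing x γ - pairing x γ'⁻¹) μ := i1.sub h2
    rw [hconj, integral_add i2 h3, integral_sub i1 h2, integral_sub (integrable_const _) h1]
    simp only [exponent, integral_const, probReal_univ, one_smul]
    ring
  have hb : ∀ γ : Dual G, MemLp (fun x => 1 - pairing x γ) (ENNReal.ofReal 2) μ := fun γ =>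
    MemLp.of_bound (measurable_const.sub (measurable_pairing γ)).aestronglyMeasurable 2
      (Eventually.of_forall fun x => (norm_sub_le _ _).trans (by simp; norm_num))
  have hpq : (2 : ℝ).HolderConjugate 2 := Real.HolderConjugate.two_two
  have hcs := integral_mul_norm_le_Lp_mul_Lq hpq (hb γ) (hb γ')
  simp_rw [Real.rpow_two, integral_norm_one_sub_pairing_sq] at hcs
  rw [e, norm_neg, Complex.conj_re]
  have h4 : ‖∫ x, (1 - pairing x γ) * starRingEnd ℂ (1 - pairing x γ') ∂μ‖
      ≤ ∫ x, ‖1 - pairing x γ‖ * ‖1 - pairing x γ'‖ ∂μ := by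
    refine (norm_integral_le_integral_norm _).trans (le_of_eq ?_)
    simp_rw [norm_mul, RCLike.norm_conj]
  have r1 := exponent_re_nonneg (μ := μ) γ
  have r2 := exponent_re_nonneg (μ := μ) γ'
  rw [← Real.sqrt_eq_rpow, ← Real.sqrt_eq_rpow, ← Real.sqrt_mul (by positivity)] at hcs
  calc _ ≤ (√(2 * (exponent μ γ).re * (2 * (exponent μ γ').re))) ^ 2 := by
        gcongr; exact h4.trans hcs
    _ = _ := by rw [Real.sq_sqrt (by positivity)]; ring

end Exponent

/-! ### A bound for the aggregation that is uniform in the character -/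

section Tail

variable {G : Type*} [AddCommGroup G]

open Classical in
/-- The sum of the weights `e^{k/(3m)}` of the nonzero cells. Up to a factor `2` it bounds the
aggregation, for all characters at once. -/
def weightSum (m : ℕ) (x : ℤ → G) : ℝ≥0∞ :=
  ∑' k : ℤ, if x k = 0 then 0 else ENNReal.ofReal (Real.exp (1 / 3 * ((k : ℝ) / m)))

theorem measurable_weightSum [MeasurableSpace G] [MeasurableSingletonClass G] (m : ℕ) :
    Measurable (weightSum m : (ℤ → G) → ℝ≥0∞) := by
  classical
  refine Measurable.tsum fun k => ?_
  exact Measurable.ite (measurable_pi_apply k (measurableSet_singleton 0)) measurable_const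
    measurable_const

variable [TopologicalSpace G]

theorem enorm_aggregationTerm_le (m : ℕ) (x : ℤ → G) (γ : Dual G) (k : ℤ) [Decidable (x k = 0)] :
    ‖aggregationTerm m x γ k‖ₑ
      ≤ 2 * if x k = 0 then 0 else ENNReal.ofReal (Real.exp (1 / 3 * ((k : ℝ) / m))) := by
  unfold aggregationTerm
  split_ifs with h
  · simp [h]
  · have h2 : ‖pairing (x k) γ - 1‖ₑ ≤ 2 := by
      rw [← ofReal_norm]
      refine ENNReal.ofReal_le_of_le_toReal ((norm_sub_le _ _).trans ?_)
      rw [norm_pairing, norm_one]; norm_num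
    rw [enorm_mul]
    gcongr
    rw [← ofReal_norm, Complex.norm_real, Real.norm_of_nonneg (Real.exp_pos _).le]

theorem tsum_enorm_aggregationTerm_le (m : ℕ) (x : ℤ → G) (γ : Dual G) :
    ∑' k, ‖aggregationTerm m x γ k‖ₑ ≤ 2 * weightSum m x := by
  classical
  rw [weightSum, ← ENNReal.tsum_mul_left]
  refine ENNReal.tsum_le_tsum fun k => ?_
  convert! enorm_aggregationTerm_le m x γ k

theorem enorm_aggregation_le (m : ℕ) (x : ℤ → G) (γ : Dual G) :
    ‖aggregation m x γ‖ₑ ≤ 2 * weightSum m x :=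
  enorm_tsum_le_tsum_enorm.trans (tsum_enorm_aggregationTerm_le m x γ)

theorem summable_norm_aggregationTerm {m : ℕ} {x : ℤ → G} (h : weightSum m x < ∞) (γ : Dual G) :
    Summable fun k => ‖aggregationTerm m x γ k‖ :=
  tsum_enorm_ne_top_iff_summable_norm.1
    ((tsum_enorm_aggregationTerm_le m x γ).trans_lt (ENNReal.mul_lt_top (by simp) h)).ne

theorem summable_aggregationTerm {m : ℕ} {x : ℤ → G} (h : weightSum m x < ∞) (γ : Dual G) :
    Summable (aggregationTerm m x γ) :=
  (summable_norm_aggregationTerm h γ).of_norm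

/-- Measurability of aggregations, in whatever parameters they depend on, from that of the
pairings. -/
theorem aestronglyMeasurable_aggregation {α : Type*} [MeasurableSpace α] {M : Measure α} {m : ℕ}
    {x : α → ℤ → G} {γ : α → Dual G}
    (h : ∀ k, AEStronglyMeasurable (fun a => pairing (x a k) (γ a)) M)
    (hw : ∀ᵐ a ∂M, weightSum m (x a) < ∞) :
    AEStronglyMeasurable (fun a => aggregation m (x a) (γ a)) M := by
  refine aestronglyMeasurable_of_tendsto_ae atTop
    (f := fun (s : Finset ℤ) a => ∑ k ∈ s, aggregationTerm m (x a) (γ a) k) (fun s => ?_) ?_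
  · refine Finset.aestronglyMeasurable_fun_sum s fun k _ => ?_
    exact ((h k).sub aestronglyMeasurable_const).mul_const _
  · filter_upwards [hw] with a ha
    exact (summable_aggregationTerm ha (γ a)).hasSum

end Tail

/-! ### Moments of a single tower -/

/-- Summability of the weights against the square roots of the probabilities of nonzero cells,
which are bounded by `measure_ne_zero_le`. -/
theorem tsum_weight_mul_lt_top {lam : ℝ} {m : ℕ} (hm : 1 ≤ m) :
    ∑' k : ℤ, ENNReal.ofReal (Real.exp (1 / 3 * ((k : ℝ) / m))) *
      ENNReal.ofReal (min 2 (Real.exp (-((k : ℝ) / (2 * m))) * √lam)) < ∞ := by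
  have hm' : (1 : ℝ) ≤ 2 * m := by
    have : (1 : ℝ) ≤ m := by exact_mod_cast hm
    linarith
  have h := (summable_min_mul_exp_and_tsum_le (a := 2 / 3) (m := 2 * m) (by norm_num)
    (by norm_num) hm' (Real.sqrt_nonneg lam)).1
  have e : ∀ k : ℤ, ENNReal.ofReal (Real.exp (1 / 3 * ((k : ℝ) / m))) *
      ENNReal.ofReal (min 2 (Real.exp (-((k : ℝ) / (2 * m))) * √lam))
      = ENNReal.ofReal (min 2 (Real.exp (-((k : ℝ) / (2 * m))) * √lam) *
        Real.exp (2 / 3 * ((k : ℝ) / (2 * m)))) := by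
    intro k
    rw [← ENNReal.ofReal_mul (Real.exp_pos _).le, mul_comm]
    congr 3
    have : (m : ℝ) ≠ 0 := by positivity
    field_simp
  simp_rw [e]
  exact h.tsum_ofReal_lt_top

theorem tsum_mul_add_diagonal {f g h : ℤ → ℂ} (hf : Summable f) (hg : Summable g)
    (hh : Summable h) :
    ∑' p : ℤ × ℤ, (f p.1 * g p.2 + if p.1 = p.2 then h p.1 else 0)
      = (∑' k, f k) * (∑' k, g k) + ∑' k, h k := by
  have h5 : HasSum (fun p : ℤ × ℤ => if p.1 = p.2 then h p.1 else 0) (∑' k, h k) := by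
    have hinj : Function.Injective fun k : ℤ => (k, k) := fun a b h => (Prod.mk.inj h).1
    refine (hinj.hasSum_iff ?_).1 ?_
    · rintro ⟨a, b⟩ hab
      have : a ≠ b := by rintro rfl; exact hab ⟨a, rfl⟩
      simp [this]
    · simpa only [Function.comp_def, if_true] using hh.hasSum
  rw [(summable_mul_of_summable_norm hf.norm hg.norm).tsum_add h5.summable, h5.tsum_eq,
    ← tsum_mul_tsum_of_summable_norm hf.norm hg.norm]

theorem lintegral_lt_top_of_sq {Ω : Type*} [MeasurableSpace Ω] {P : Measure Ω}
    [IsFiniteMeasure P] {W : Ω → ℝ≥0∞} (hW2 : ∫⁻ ω, W ω ^ 2 ∂P < ∞) : ∫⁻ ω, W ω ∂P < ∞ := by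
  refine (lintegral_mono (g := fun ω => 1 + W ω ^ 2) fun ω => ?_).trans_lt ?_
  · rcases le_total (W ω) 1 with h | h
    · exact h.trans le_self_add
    · refine le_trans ?_ le_add_self
      rw [sq]; exact le_mul_of_one_le_left' h
  · rw [lintegral_add_left measurable_const]
    simpa using hW2

section Single

variable {G : Type*} [AddCommGroup G] [TopologicalSpace G] [MeasurableSpace G] [BorelSpace G]
  {Ω : Type*} [MeasurableSpace Ω] {P : Measure Ω}
  {μR : Measure G} [IsProbabilityMeasure μR] {lam : ℝ} {m : ℕ} {Y : ℤ → Ω → G}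

section

variable [T2Space G] [IsProbabilityMeasure P]

theorem measure_ne_zero_le (hlam : 0 < lam) (hY : ∀ k, Measurable (Y k))
    (hl : ∀ k : ℤ, P.map (Y k) = compoundPoisson (lam * Real.exp (-((k : ℝ) / m))) μR) (k : ℤ) :
    P {ω | Y k ω ≠ 0} ≤
      ENNReal.ofReal (min 2 (Real.exp (-((k : ℝ) / (2 * m))) * √lam)) ^ 2 := by
  have h1 : P {ω | Y k ω ≠ 0} = P.map (Y k) {0}ᶜ := by
    rw [Measure.map_apply (hY k) (measurableSet_singleton 0).compl]; rfl
  have h2 : P {ω | Y k ω ≠ 0} ≤ ENNReal.ofReal (lam * Real.exp (-((k : ℝ) / m))) := by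
    rw [h1, hl]; exact compoundPoisson_compl_zero_le (by positivity)
  rw [← ENNReal.ofReal_pow (by positivity)]
  rcases min_choice 2 (Real.exp (-((k : ℝ) / (2 * m))) * √lam) with h | h
  · rw [h]
    refine prob_le_one.trans ?_
    rw [← ENNReal.ofReal_one]; exact ENNReal.ofReal_le_ofReal (by norm_num)
  · rw [h, mul_pow, Real.sq_sqrt hlam.le, ← Real.exp_nat_mul]
    refine h2.trans (le_of_eq ?_)
    rw [mul_comm lam]
    congr 3
    push_cast
    rw [mul_neg, ← mul_div_assoc, mul_div_mul_left _ _ (two_ne_zero' ℝ)]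

theorem measurable_weightSum_comp (hY : ∀ k, Measurable (Y k)) :
    Measurable fun ω => weightSum m (fun k => Y k ω) :=
  (measurable_weightSum m).comp (measurable_pi_lambda _ hY)

/-- The second moment of the weight sum, by `P (A ∩ B) ≤ (P A * P B) ^ (1 / 2)`. -/
theorem lintegral_weightSum_sq_lt_top (hlam : 0 < lam) (hm : 1 ≤ m) (hY : ∀ k, Measurable (Y k))
    (hl : ∀ k : ℤ, P.map (Y k) = compoundPoisson (lam * Real.exp (-((k : ℝ) / m))) μR) :
    ∫⁻ ω, weightSum m (fun k => Y k ω) ^ 2 ∂P < ∞ := by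
  classical
  set c : ℤ → ℝ≥0∞ := fun k => ENNReal.ofReal (Real.exp (1 / 3 * ((k : ℝ) / m))) with hc
  set q : ℤ → ℝ≥0∞ := fun k =>
    ENNReal.ofReal (min 2 (Real.exp (-((k : ℝ) / (2 * m))) * √lam)) with hq
  have hA : ∀ k, MeasurableSet {ω | Y k ω ≠ 0} := fun k =>
    (hY k (measurableSet_singleton 0)).compl
  have hw : ∀ ω, weightSum m (fun k => Y k ω)
      = ∑' k, {ω | Y k ω ≠ 0}.indicator (fun _ => c k) ω := by
    intro ω
    unfold weightSum
    congr 1; ext k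
    by_cases h : Y k ω = 0 <;> simp [h, hc]
  have hkl : ∀ k l, P ({ω | Y k ω ≠ 0} ∩ {ω | Y l ω ≠ 0}) ≤ q k * q l := by
    intro k l
    rcases le_total (q k) (q l) with h | h
    · calc _ ≤ P {ω | Y k ω ≠ 0} := measure_mono inter_subset_left
        _ ≤ q k ^ 2 := measure_ne_zero_le hlam hY hl k
        _ ≤ _ := by rw [sq]; gcongr
    · calc _ ≤ P {ω | Y l ω ≠ 0} := measure_mono inter_subset_right
        _ ≤ q l ^ 2 := measure_ne_zero_le hlam hY hl l
        _ ≤ _ := by rw [sq]; gcongr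
  have hsq : ∀ ω, weightSum m (fun k => Y k ω) ^ 2 = ∑' k, ∑' l,
      ({ω | Y k ω ≠ 0} ∩ {ω | Y l ω ≠ 0}).indicator (fun _ => c k * c l) ω := by
    intro ω
    rw [hw, sq, ← ENNReal.tsum_mul_right]
    congr 1; ext k
    rw [← ENNReal.tsum_mul_left]
    congr 1; ext l
    by_cases h : Y k ω = 0 <;> by_cases h' : Y l ω = 0 <;> simp [h, h', indicator]
  simp_rw [hsq]
  rw [lintegral_tsum fun k => (Measurable.tsum fun l =>
    measurable_const.indicator ((hA k).inter (hA l))).aemeasurable]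
  calc _ ≤ ∑' k, ∑' l, (c k * q k) * (c l * q l) := by
        refine ENNReal.tsum_le_tsum fun k => ?_
        rw [lintegral_tsum fun l => (measurable_const.indicator ((hA k).inter (hA l))).aemeasurable]
        refine ENNReal.tsum_le_tsum fun l => ?_
        rw [lintegral_indicator_const ((hA k).inter (hA l))]
        calc _ ≤ c k * c l * (q k * q l) := by gcongr; exact hkl k l
          _ = _ := by ring
    _ = (∑' k, c k * q k) * ∑' l, c l * q l := by
        simp_rw [ENNReal.tsum_mul_left, ENNReal.tsum_mul_right]
    _ < ∞ := ENNReal.mul_lt_top (tsum_weight_mul_lt_top hm)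
        (tsum_weight_mul_lt_top hm)

theorem ae_weightSum_lt_top (hlam : 0 < lam) (hm : 1 ≤ m) (hY : ∀ k, Measurable (Y k))
    (hl : ∀ k : ℤ, P.map (Y k) = compoundPoisson (lam * Real.exp (-((k : ℝ) / m))) μR) :
    ∀ᵐ ω ∂P, weightSum m (fun k => Y k ω) < ∞ := by
  filter_upwards [ae_lt_top ((measurable_weightSum_comp hY).pow_const 2)
    (lintegral_weightSum_sq_lt_top hlam hm hY hl).ne] with ω hω
  by_contra h
  simp only [not_lt, top_le_iff] at h
  simp [h] at hω

theorem lintegral_weightSum_lt_top (hlam : 0 < lam) (hm : 1 ≤ m) (hY : ∀ k, Measurable (Y k))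
    (hl : ∀ k : ℤ, P.map (Y k) = compoundPoisson (lam * Real.exp (-((k : ℝ) / m))) μR) :
    ∫⁻ ω, weightSum m (fun k => Y k ω) ∂P < ∞ :=
  lintegral_lt_top_of_sq (lintegral_weightSum_sq_lt_top hlam hm hY hl)

end

theorem integrable_pairing_cell [IsProbabilityMeasure P] (hY : ∀ k, Measurable (Y k)) (γ : Dual G)
    (k : ℤ) : Integrable (fun ω => pairing (Y k ω) γ) P :=
  Integrable.of_bound ((measurable_pairing γ).comp (hY k)).aestronglyMeasurable 1
    (Eventually.of_forall fun _ => (norm_pairing _ γ).le)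

theorem measurable_aggregationTerm (hY : ∀ k, Measurable (Y k)) (γ : Dual G) (k : ℤ) :
    Measurable fun ω => aggregationTerm m (fun k => Y k ω) γ k :=
  (((measurable_pairing γ).comp (hY k)).sub measurable_const).mul_const _

variable [IsTopologicalAddGroup G]

theorem integral_pairing_cell [IsProbabilityMeasure P] (hlam : 0 < lam)
    (hY : ∀ k, Measurable (Y k))
    (hl : ∀ k : ℤ, P.map (Y k) = compoundPoisson (lam * Real.exp (-((k : ℝ) / m))) μR)
    (γ : Dual G) (k : ℤ) : ∫ ω, pairing (Y k ω) γ ∂P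
      = Complex.exp (-((Real.exp (-((k : ℝ) / m)) : ℝ) * (lam * exponent μR γ))) := by
  have hp : IsProbabilityMeasure (compoundPoisson (lam * Real.exp (-((k : ℝ) / m))) μR) :=
    hl k ▸ Measure.isProbabilityMeasure_map (hY k).aemeasurable
  rw [← integral_map (hY k).aemeasurable (measurable_pairing γ).aestronglyMeasurable (f :=
    fun x => pairing x γ), hl, integral_pairing_compoundPoisson (by positivity)]
  congr 1
  unfold exponent
  push_cast
  ring

theorem integral_aggregationTerm [IsProbabilityMeasure P] (hlam : 0 < lam)
    (hY : ∀ k, Measurable (Y k))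
    (hl : ∀ k : ℤ, P.map (Y k) = compoundPoisson (lam * Real.exp (-((k : ℝ) / m))) μR)
    (γ : Dual G) (k : ℤ) : ∫ ω, aggregationTerm m (fun k => Y k ω) γ k ∂P
      = laplaceTerm (1 / 3) m (lam * exponent μR γ) k := by
  simp only [aggregationTerm]
  rw [integral_mul_const, integral_sub (integrable_pairing_cell hY γ k) (integrable_const _),
    integral_pairing_cell hlam hY hl]
  simp [laplaceTerm]

/-- Distinct cells are uncorrelated, and the covariance within one cell is a difference of
characteristic functions. -/
theorem integral_aggregationTerm_mul_conj [IsProbabilityMeasure P] (hlam : 0 < lam)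
    (hY : ∀ k, Measurable (Y k)) (hi : ∀ k l, k ≠ l → IndepFun (Y k) (Y l) P)
    (hl : ∀ k : ℤ, P.map (Y k) = compoundPoisson (lam * Real.exp (-((k : ℝ) / m))) μR)
    (γ γ' : Dual G) (k l : ℤ) :
    ∫ ω, aggregationTerm m (fun k => Y k ω) γ k
        * starRingEnd ℂ (aggregationTerm m (fun k => Y k ω) γ' l) ∂P
      = laplaceTerm (1 / 3) m (lam * exponent μR γ) k
          * starRingEnd ℂ (laplaceTerm (1 / 3) m (lam * exponent μR γ') l)
        + if k = l then laplaceTerm (2 / 3) m (lam * exponent μR (γ * γ'⁻¹)) k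
          - laplaceTerm (2 / 3) m (lam * (exponent μR γ + starRingEnd ℂ (exponent μR γ'))) k
          else 0 := by
  rw [← integral_aggregationTerm hlam hY hl, ← integral_aggregationTerm hlam hY hl, ← integral_conj]
  split_ifs with h
  · subst h
    simp_rw [integral_conj, integral_aggregationTerm hlam hY hl]
    have e : ∀ ω, aggregationTerm m (fun k => Y k ω) γ k
        * starRingEnd ℂ (aggregationTerm m (fun k => Y k ω) γ' k)
        = (pairing (Y k ω) (γ * γ'⁻¹) - pairing (Y k ω) γ - pairing (Y k ω) γ'⁻¹ + 1)
          * (Real.exp (2 / 3 * ((k : ℝ) / m)) : ℝ) := by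
      intro ω
      have e2 : Real.exp (2 / 3 * ((k : ℝ) / m))
          = Real.exp (1 / 3 * ((k : ℝ) / m)) * Real.exp (1 / 3 * ((k : ℝ) / m)) := by
        rw [← Real.exp_add]; congr 1; ring
      simp only [aggregationTerm, e2, map_mul, map_sub, map_one, Complex.conj_ofReal,
        pairing_mul_inv, pairing_inv, Complex.ofReal_mul]
      ring
    have hint := fun γ : Dual G => integrable_pairing_cell (P := P) hY γ k
    have i1 : Integrable (fun ω => pairing (Y k ω) (γ * γ'⁻¹) - pairing (Y k ω) γ) P :=
      (hint _).sub (hint _)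
    have i2 : Integrable (fun ω => pairing (Y k ω) (γ * γ'⁻¹) - pairing (Y k ω) γ
      - pairing (Y k ω) γ'⁻¹) P := i1.sub (hint _)
    simp_rw [e]
    rw [integral_mul_const, integral_add i2 (integrable_const _), integral_sub i1 (hint _),
      integral_sub (hint _) (hint _), integral_pairing_cell hlam hY hl,
      integral_pairing_cell hlam hY hl]
    have e3 : ∫ ω, pairing (Y k ω) γ'⁻¹ ∂P = starRingEnd ℂ (∫ ω, pairing (Y k ω) γ' ∂P) := by
      simp_rw [pairing_inv]; rw [integral_conj]
    rw [e3, integral_pairing_cell hlam hY hl]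
    have e2 : Real.exp (2 / 3 * ((k : ℝ) / m))
        = Real.exp (1 / 3 * ((k : ℝ) / m)) * Real.exp (1 / 3 * ((k : ℝ) / m)) := by
      rw [← Real.exp_add]; congr 1; ring
    have e4 : ∀ z w : ℂ, Complex.exp (-((Real.exp (-((k : ℝ) / m)) : ℝ) * (lam * (z + w))))
        = Complex.exp (-((Real.exp (-((k : ℝ) / m)) : ℝ) * (lam * z)))
          * Complex.exp (-((Real.exp (-((k : ℝ) / m)) : ℝ) * (lam * w))) := by
      intro z w; rw [← Complex.exp_add]; congr 1; ring
    simp only [laplaceTerm, e2, e4, map_mul, map_sub, map_one, Complex.conj_ofReal, map_neg,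
      Complex.ofReal_mul, ← Complex.exp_conj, integral_const, probReal_univ, one_smul]
    ring
  · rw [add_zero]
    have := (hi k l h).integral_fun_comp_mul_comp (hY k).aemeasurable (hY l).aemeasurable
      (f := fun x => (pairing x γ - 1) * (Real.exp (1 / 3 * ((k : ℝ) / m)) : ℂ))
      (g := fun x => starRingEnd ℂ ((pairing x γ' - 1) * (Real.exp (1 / 3 * ((l : ℝ) / m)) : ℂ)))
      (((measurable_pairing γ).sub measurable_const).mul_const _).aestronglyMeasurable
      (Complex.continuous_conj.measurable.comp
        (((measurable_pairing γ').sub measurable_const).mul_const _)).aestronglyMeasurable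
    exact this

variable [T2Space G]

/-- The mean of the aggregation. -/
theorem integral_aggregation [IsProbabilityMeasure P] (hlam : 0 < lam) (hm : 1 ≤ m)
    (hY : ∀ k, Measurable (Y k))
    (hl : ∀ k : ℤ, P.map (Y k) = compoundPoisson (lam * Real.exp (-((k : ℝ) / m))) μR)
    (γ : Dual G) : ∫ ω, aggregation m (fun k => Y k ω) γ ∂P
      = laplaceSum (1 / 3) m (lam * exponent μR γ) := by
  simp only [aggregation, laplaceSum]
  rw [integral_tsum (fun k => (measurable_aggregationTerm hY γ k).aestronglyMeasurable)]
  · simp_rw [integral_aggregationTerm hlam hY hl]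
  · rw [← lintegral_tsum fun k => (measurable_aggregationTerm hY γ k).enorm.aemeasurable]
    refine ((lintegral_mono fun ω => tsum_enorm_aggregationTerm_le m _ γ).trans_lt ?_).ne
    rw [lintegral_const_mul' _ _ (by simp)]
    exact ENNReal.mul_lt_top (by simp) (lintegral_weightSum_lt_top hlam hm hY hl)

/-- The mixed second moment of the aggregation at two characters. -/
theorem integral_aggregation_mul_conj [IsProbabilityMeasure P] (hlam : 0 < lam) (hm : 1 ≤ m)
    (hY : ∀ k, Measurable (Y k)) (hi : ∀ k l, k ≠ l → IndepFun (Y k) (Y l) P)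
    (hl : ∀ k : ℤ, P.map (Y k) = compoundPoisson (lam * Real.exp (-((k : ℝ) / m))) μR)
    (γ γ' : Dual G) :
    ∫ ω, aggregation m (fun k => Y k ω) γ
        * starRingEnd ℂ (aggregation m (fun k => Y k ω) γ') ∂P
      = laplaceSum (1 / 3) m (lam * exponent μR γ)
          * laplaceSum (1 / 3) m (lam * starRingEnd ℂ (exponent μR γ'))
        + (laplaceSum (2 / 3) m (lam * exponent μR (γ * γ'⁻¹))
          - laplaceSum (2 / 3) m
              (lam * (exponent μR γ + starRingEnd ℂ (exponent μR γ')))) := by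
  have hm' : (1 : ℝ) ≤ m := by exact_mod_cast hm
  have hre : ∀ {z : ℂ}, 0 ≤ z.re → 0 ≤ ((lam : ℂ) * z).re := by
    intro z hz; rw [Complex.re_ofReal_mul]; positivity
  have r1 := exponent_re_nonneg (μ := μR) γ
  have r2 := exponent_re_nonneg (μ := μR) γ'
  have r3 := exponent_re_nonneg (μ := μR) (γ * γ'⁻¹)
  set T : ℤ × ℤ → Ω → ℂ := fun p ω => aggregationTerm m (fun k => Y k ω) γ p.1
    * starRingEnd ℂ (aggregationTerm m (fun k => Y k ω) γ' p.2) with hT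
  have hTm : ∀ p, Measurable (T p) := fun p =>
    (measurable_aggregationTerm hY γ p.1).mul
      (Complex.continuous_conj.measurable.comp (measurable_aggregationTerm hY γ' p.2))
  have hsum : ∀ᵐ ω ∂P, aggregation m (fun k => Y k ω) γ
      * starRingEnd ℂ (aggregation m (fun k => Y k ω) γ') = ∑' p, T p ω := by
    filter_upwards [ae_weightSum_lt_top hlam hm hY hl] with ω hω
    rw [aggregation, aggregation, Complex.conj_tsum]
    refine tsum_mul_tsum_of_summable_norm (summable_norm_aggregationTerm hω γ) ?_
    simpa only [RCLike.norm_conj] using summable_norm_aggregationTerm hω γ'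
  rw [integral_congr_ae hsum, integral_tsum (fun p => (hTm p).aestronglyMeasurable)]
  · simp_rw [hT, integral_aggregationTerm_mul_conj hlam hY hi hl]
    have s1 : Summable fun k : ℤ => laplaceTerm (1 / 3) m (lam * exponent μR γ) k :=
      summable_laplaceTerm (by norm_num) (by norm_num) hm' (hre r1)
    have s2 : Summable fun k : ℤ =>
        starRingEnd ℂ (laplaceTerm (1 / 3) m (lam * exponent μR γ') k) := by
      simp_rw [conj_laplaceTerm, conj_ofReal_mul_exponent]
      exact summable_laplaceTerm (by norm_num) (by norm_num) hm' (hre (by simpa using r2))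
    have s3 : Summable fun k : ℤ => laplaceTerm (2 / 3) m (lam * exponent μR (γ * γ'⁻¹)) k :=
      summable_laplaceTerm (by norm_num) (by norm_num) hm' (hre r3)
    have s4 : Summable fun k : ℤ => laplaceTerm (2 / 3) m
        (lam * (exponent μR γ + starRingEnd ℂ (exponent μR γ'))) k :=
      summable_laplaceTerm (by norm_num) (by norm_num) hm'
        (hre (by rw [Complex.add_re, Complex.conj_re]; positivity))
    rw [tsum_mul_add_diagonal s1 s2 (s3.sub s4), s3.tsum_sub s4]
    simp only [conj_laplaceTerm, conj_ofReal_mul_exponent, laplaceSum]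
  · rw [← lintegral_tsum fun p => (hTm p).enorm.aemeasurable]
    refine ((lintegral_mono (g := fun ω => 4 * weightSum m (fun k => Y k ω) ^ 2)
      fun ω => ?_).trans_lt ?_).ne
    · simp only [hT, enorm_mul]
      rw [ENNReal.tsum_prod (f := fun k l => ‖aggregationTerm m (fun k => Y k ω) γ k‖ₑ
        * ‖starRingEnd ℂ (aggregationTerm m (fun k => Y k ω) γ' l)‖ₑ)]
      simp_rw [ENNReal.tsum_mul_left, ENNReal.tsum_mul_right, RCLike.enorm_conj]
      refine (mul_le_mul' (tsum_enorm_aggregationTerm_le m _ γ)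
        (tsum_enorm_aggregationTerm_le m _ γ')).trans (le_of_eq ?_)
      ring
    · rw [lintegral_const_mul' _ _ (by simp)]
      exact ENNReal.mul_lt_top (by simp) (lintegral_weightSum_sq_lt_top hlam hm hY hl)

end Single

/-! ### Moments of a triple tower -/

/-- If all members of a doubly indexed family are independent, then so are its rows. -/
theorem iIndepFun_rows {ι κ Ω α : Type*} [MeasurableSpace Ω] [MeasurableSpace α] {P : Measure Ω}
    {X : ι → κ → Ω → α} (hX : ∀ i j, Measurable (X i j))
    (h : iIndepFun (fun p : ι × κ => X p.1 p.2) P) :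
    iIndepFun (fun i ω j => X i j ω) P := by
  have := h.isProbabilityMeasure
  have : ∀ i j, IsProbabilityMeasure (P.map (X i j)) := fun i j =>
    Measure.isProbabilityMeasure_map (hX i j).aemeasurable
  have hrow : ∀ i, iIndepFun (X i) P := fun i =>
    h.precomp (g := fun j : κ => (i, j)) fun a b hab => (Prod.mk.inj hab).2
  rw [iIndepFun_iff_map_fun_eq_infinitePi_map (fun i => measurable_pi_lambda _ (hX i))]
  have h1 : ∀ i, P.map (fun ω j => X i j ω) = Measure.infinitePi fun j => P.map (X i j) := fun i =>
    (iIndepFun_iff_map_fun_eq_infinitePi_map (hX i)).1 (hrow i)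
  simp_rw [h1]
  rw [← Measure.infinitePi_map_curry (fun i j => P.map (X i j)),
    ← (iIndepFun_iff_map_fun_eq_infinitePi_map (fun p : ι × κ => hX p.1 p.2)).1 h,
    Measure.map_map (by fun_prop) (measurable_pi_lambda _ fun p : ι × κ => hX p.1 p.2)]
  rfl

section Triple

variable {G : Type*} [AddCommGroup G] [TopologicalSpace G] [T2Space G]
  [MeasurableSpace G] [BorelSpace G]
  {Ω : Type*} [MeasurableSpace Ω] {P : Measure Ω} [IsProbabilityMeasure P]
  {μR : Measure G} [IsProbabilityMeasure μR] {lam : ℝ} {m : ℕ} {X : Fin 3 → ℤ → Ω → G}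

theorem ae_forall_weightSum_lt_top (hX : IsTriplePoissonTower P μR lam m X) (hlam : 0 < lam)
    (hm : 1 ≤ m) : ∀ᵐ ω ∂P, ∀ j, weightSum m (fun k => X j k ω) < ∞ :=
  ae_all_iff.2 fun j => ae_weightSum_lt_top hlam hm (hX.measurable j) (hX.law j)

theorem lintegral_prod_weightSum_sq_lt_top (hX : IsTriplePoissonTower P μR lam m X)
    (hlam : 0 < lam) (hm : 1 ≤ m) :
    ∫⁻ ω, (∏ j, weightSum m (fun k => X j k ω)) ^ 2 ∂P < ∞ := by
  have hI := (iIndepFun_rows hX.measurable hX.indep).comp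
    (fun _ x => weightSum m x ^ 2) (fun _ => (measurable_weightSum m).pow_const 2)
  have := lintegral_prod_eq_prod_lintegral_of_indepFun Finset.univ _ hI
    (fun j => (measurable_weightSum_comp (m := m) (hX.measurable j)).pow_const 2)
  simp only [Function.comp_apply] at this
  simp_rw [← Finset.prod_pow]
  rw [this]
  exact ENNReal.prod_lt_top fun j _ =>
    lintegral_weightSum_sq_lt_top hlam hm (hX.measurable j) (hX.law j)

theorem aestronglyMeasurable_aggregation_map (hX : IsTriplePoissonTower P μR lam m X)
    (hlam : 0 < lam) (hm : 1 ≤ m) (γ : Dual G) (j : Fin 3) :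
    AEStronglyMeasurable (fun x : ℤ → G => aggregation m x γ)
      (P.map fun ω k => X j k ω) := by
  refine aestronglyMeasurable_aggregation (γ := fun _ => γ) (fun k => ?_) ?_
  · exact ((measurable_pairing γ).comp (measurable_pi_apply k)).aestronglyMeasurable
  · rw [ae_map_iff (measurable_pi_lambda _ (hX.measurable j)).aemeasurable
      (measurableSet_lt (measurable_weightSum m) measurable_const)]
    exact ae_weightSum_lt_top hlam hm (hX.measurable j) (hX.law j)

variable [IsTopologicalAddGroup G]

theorem integral_prod_aggregation (hX : IsTriplePoissonTower P μR lam m X)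
    (hlam : 0 < lam) (hm : 1 ≤ m) (γ : Dual G) :
    ∫ ω, ∏ j, aggregation m (fun k => X j k ω) γ ∂P
      = laplaceSum (1 / 3) m (lam * exponent μR γ) ^ 3 := by
  have := (iIndepFun_rows hX.measurable hX.indep).integral_fun_prod_comp
    (fun j => (measurable_pi_lambda _ (hX.measurable j)).aemeasurable)
    (f := fun _ x => aggregation m x γ)
    (fun j => aestronglyMeasurable_aggregation_map hX hlam hm γ j)
  rw [this]
  simp_rw [fun j => integral_aggregation hlam hm (hX.measurable j) (hX.law j) γ]
  simp

theorem integral_prod_aggregation_mul_conj (hX : IsTriplePoissonTower P μR lam m X)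
    (hlam : 0 < lam) (hm : 1 ≤ m) (γ γ' : Dual G) :
    ∫ ω, (∏ j, aggregation m (fun k => X j k ω) γ)
        * starRingEnd ℂ (∏ j, aggregation m (fun k => X j k ω) γ') ∂P
      = (laplaceSum (1 / 3) m (lam * exponent μR γ)
          * laplaceSum (1 / 3) m (lam * starRingEnd ℂ (exponent μR γ'))
        + (laplaceSum (2 / 3) m (lam * exponent μR (γ * γ'⁻¹))
          - laplaceSum (2 / 3) m
              (lam * (exponent μR γ + starRingEnd ℂ (exponent μR γ'))))) ^ 3 := by
  have := (iIndepFun_rows hX.measurable hX.indep).integral_fun_prod_comp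
    (fun j => (measurable_pi_lambda _ (hX.measurable j)).aemeasurable)
    (f := fun _ x => aggregation m x γ * starRingEnd ℂ (aggregation m x γ'))
    (fun j => (aestronglyMeasurable_aggregation_map hX hlam hm γ j).mul
      (Complex.continuous_conj.comp_aestronglyMeasurable
        (aestronglyMeasurable_aggregation_map hX hlam hm γ' j)))
  simp_rw [map_prod, ← Finset.prod_mul_distrib]
  rw [this]
  have hi : ∀ j k l, k ≠ l → IndepFun (X j k) (X j l) P := fun j k l hkl =>
    hX.indep.indepFun (i := (j, k)) (j := (j, l)) fun h => hkl (Prod.mk.inj h).2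
  simp_rw [fun j => integral_aggregation_mul_conj hlam hm (hX.measurable j) (hi j) (hX.law j) γ γ']
  simp

end Triple

/-! ### The variance of a random integral -/

section Fubini

variable {Ω Γ : Type*} [MeasurableSpace Ω] [MeasurableSpace Γ] {P : Measure Ω}
  {ν : Measure Γ} [SigmaFinite ν] {H : Ω → Γ → ℂ} {W : Ω → ℝ≥0∞}
  {F : Γ → ℂ}

theorem quasiMeasurePreserving_prodMap {α β α' β' : Type*} [MeasurableSpace α] [MeasurableSpace β]
    [MeasurableSpace α'] [MeasurableSpace β'] {μ : Measure α} {ν : Measure β} {μ' : Measure α'}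
    {ν' : Measure β'} [SFinite μ] [SFinite ν] [SFinite ν'] {f : α → α'} {g : β → β'}
    (hf : Measure.QuasiMeasurePreserving f μ μ') (hg : Measure.QuasiMeasurePreserving g ν ν') :
    Measure.QuasiMeasurePreserving (Prod.map f g) (μ.prod ν) (μ'.prod ν') := by
  refine ⟨hf.measurable.prodMap hg.measurable, ?_⟩
  rw [← Measure.map_prod_map μ ν hf.measurable hg.measurable]
  exact hf.absolutelyContinuous.prod hg.absolutelyContinuous

theorem integrable_uncurry_of_enorm_le [IsProbabilityMeasure P]
    (hH : AEStronglyMeasurable (Function.uncurry H) (P.prod ν))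
    (hW : AEMeasurable W P) (hW2 : ∫⁻ ω, W ω ^ 2 ∂P < ∞) (hF : Integrable F ν)
    (hb : ∀ ω γ, ‖H ω γ‖ₑ ≤ W ω * ‖F γ‖ₑ) : Integrable (Function.uncurry H) (P.prod ν) := by
  refine ⟨hH, ?_⟩
  refine (lintegral_mono (g := fun p : Ω × Γ => W p.1 * ‖F p.2‖ₑ) fun p => hb p.1 p.2).trans_lt ?_
  rw [lintegral_prod_mul hW hF.1.enorm]
  exact ENNReal.mul_lt_top (lintegral_lt_top_of_sq hW2) hF.2

/-- Minkowski's inequality, in the case of a bound of product form. -/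
theorem memLp_two_integral_of_enorm_le
    (hH : AEStronglyMeasurable (Function.uncurry H) (P.prod ν))
    (hW2 : ∫⁻ ω, W ω ^ 2 ∂P < ∞) (hF : Integrable F ν)
    (hb : ∀ ω γ, ‖H ω γ‖ₑ ≤ W ω * ‖F γ‖ₑ) : MemLp (fun ω => ∫ γ, H ω γ ∂ν) 2 P := by
  refine ⟨hH.integral_prod_right', ?_⟩
  rw [eLpNorm_lt_top_iff_lintegral_rpow_enorm_lt_top two_ne_zero ENNReal.ofNat_ne_top]
  have hle : ∀ ω, ‖∫ γ, H ω γ ∂ν‖ₑ ≤ W ω * ∫⁻ γ, ‖F γ‖ₑ ∂ν := fun ω => by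
    refine (enorm_integral_le_lintegral_enorm _).trans ?_
    rw [← lintegral_const_mul'' _ hF.1.enorm]
    exact lintegral_mono fun γ => hb ω γ
  refine (lintegral_mono (g := fun ω => W ω ^ 2 * (∫⁻ γ, ‖F γ‖ₑ ∂ν) ^ 2) fun ω => ?_).trans_lt ?_
  · change _ ≤ W ω ^ 2 * (∫⁻ γ, ‖F γ‖ₑ ∂ν) ^ 2
    rw [ENNReal.toReal_ofNat, ENNReal.rpow_two, ← mul_pow]
    gcongr
    exact hle ω
  · rw [lintegral_mul_const' _ _ (ENNReal.pow_ne_top hF.2.ne)]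
    exact ENNReal.mul_lt_top hW2 (ENNReal.pow_lt_top hF.2)

theorem complexVariance_eq_sub [IsProbabilityMeasure P] {Y : Ω → ℂ} (hY : MemLp Y 2 P) :
    complexVariance P Y = (∫ ω, Y ω * starRingEnd ℂ (Y ω) ∂P)
      - (∫ ω, Y ω ∂P) * starRingEnd ℂ (∫ ω, Y ω ∂P) := by
  have h1 : Integrable Y P := hY.integrable (by norm_num)
  have h1' : Integrable (fun ω => starRingEnd ℂ (Y ω)) P :=
    (Complex.conjCLE.toContinuousLinearMap.integrable_comp h1)
  have h2 : Integrable (fun ω => Y ω * starRingEnd ℂ (Y ω)) P :=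
    hY.integrable_mul (hY.star)
  unfold complexVariance
  set e := ∫ ω, Y ω ∂P with he
  have e1 : ∀ ω, (Y ω - e) * starRingEnd ℂ (Y ω - e)
      = Y ω * starRingEnd ℂ (Y ω) - e * starRingEnd ℂ (Y ω) - Y ω * starRingEnd ℂ e
        + e * starRingEnd ℂ e := by
    intro ω; rw [map_sub]; ring
  have i1 : Integrable (fun ω => Y ω * starRingEnd ℂ (Y ω) - e * starRingEnd ℂ (Y ω)) P :=
    h2.sub (h1'.const_mul _)
  have i2 : Integrable (fun ω => Y ω * starRingEnd ℂ (Y ω) - e * starRingEnd ℂ (Y ω)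
      - Y ω * starRingEnd ℂ e) P := i1.sub (h1.mul_const _)
  simp_rw [e1]
  rw [integral_add i2 (integrable_const _), integral_sub i1 (h1.mul_const _),
    integral_sub h2 (h1'.const_mul _), integral_const_mul, integral_mul_const, integral_conj,
    ← he]
  simp

/-- The variance of an integral over a parameter is the double integral of the covariances. -/
theorem complexVariance_integral_eq [IsProbabilityMeasure P]
    (hH : AEStronglyMeasurable (Function.uncurry H) (P.prod ν))
    (hW : AEMeasurable W P) (hW2 : ∫⁻ ω, W ω ^ 2 ∂P < ∞) (hF : Integrable F ν)
    (hb : ∀ ω γ, ‖H ω γ‖ₑ ≤ W ω * ‖F γ‖ₑ) :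
    Integrable (fun p : Γ × Γ => (∫ ω, H ω p.1 * starRingEnd ℂ (H ω p.2) ∂P)
        - (∫ ω, H ω p.1 ∂P) * starRingEnd ℂ (∫ ω, H ω p.2 ∂P)) (ν.prod ν) ∧
    complexVariance P (fun ω => ∫ γ, H ω γ ∂ν)
      = ∫ p : Γ × Γ, ((∫ ω, H ω p.1 * starRingEnd ℂ (H ω p.2) ∂P)
        - (∫ ω, H ω p.1 ∂P) * starRingEnd ℂ (∫ ω, H ω p.2 ∂P)) ∂(ν.prod ν) := by
  have hHi := integrable_uncurry_of_enorm_le hH hW hW2 hF hb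
  have hT1 : AEStronglyMeasurable (fun p : Ω × (Γ × Γ) => H p.1 p.2.1) (P.prod (ν.prod ν)) :=
    hH.comp_quasiMeasurePreserving (quasiMeasurePreserving_prodMap
      (Measure.QuasiMeasurePreserving.id P) Measure.quasiMeasurePreserving_fst)
  have hT2 : AEStronglyMeasurable (fun p : Ω × (Γ × Γ) => H p.1 p.2.2) (P.prod (ν.prod ν)) :=
    hH.comp_quasiMeasurePreserving (quasiMeasurePreserving_prodMap
      (Measure.QuasiMeasurePreserving.id P) Measure.quasiMeasurePreserving_snd)
  have hT : Integrable (Function.uncurry fun (ω : Ω) (p : Γ × Γ) =>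
      H ω p.1 * starRingEnd ℂ (H ω p.2)) (P.prod (ν.prod ν)) := by
    refine ⟨hT1.mul (Complex.continuous_conj.comp_aestronglyMeasurable hT2), ?_⟩
    refine (lintegral_mono (g := fun q : Ω × (Γ × Γ) => W q.1 ^ 2 * (‖F q.2.1‖ₑ * ‖F q.2.2‖ₑ))
      fun q => ?_).trans_lt ?_
    · simp only [Function.uncurry, enorm_mul, RCLike.enorm_conj]
      refine (mul_le_mul' (hb q.1 q.2.1) (hb q.1 q.2.2)).trans (le_of_eq (by ring))
    · have hFm : AEMeasurable (fun q : Γ × Γ => ‖F q.1‖ₑ * ‖F q.2‖ₑ) (ν.prod ν) :=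
        hF.1.enorm.comp_fst.mul hF.1.enorm.comp_snd
      rw [lintegral_prod_mul (f := fun ω => W ω ^ 2) (hW.pow_const 2) hFm,
        lintegral_prod_mul hF.1.enorm hF.1.enorm]
      exact ENNReal.mul_lt_top hW2 (ENNReal.mul_lt_top hF.2 hF.2)
  have h1 : Integrable (fun p : Γ × Γ => ∫ ω, H ω p.1 * starRingEnd ℂ (H ω p.2) ∂P) (ν.prod ν) :=
    hT.integral_prod_right
  have h2 : Integrable (fun γ => ∫ ω, H ω γ ∂P) ν := hHi.integral_prod_right
  have h2' : Integrable (fun γ => starRingEnd ℂ (∫ ω, H ω γ ∂P)) ν :=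
    Complex.conjCLE.toContinuousLinearMap.integrable_comp h2
  have h3 : Integrable (fun p : Γ × Γ => (∫ ω, H ω p.1 ∂P) * starRingEnd ℂ (∫ ω, H ω p.2 ∂P))
      (ν.prod ν) := h2.mul_prod h2'
  refine ⟨h1.sub h3, ?_⟩
  rw [complexVariance_eq_sub (memLp_two_integral_of_enorm_le hH hW2 hF hb), integral_sub h1 h3]
  congr 1
  · rw [← integral_integral_swap hT]
    refine integral_congr_ae (Eventually.of_forall fun ω => ?_)
    simp only
    rw [← integral_conj]
    exact (integral_prod_mul (fun γ => H ω γ) (fun γ => starRingEnd ℂ (H ω γ))).symm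
  · rw [integral_integral_swap hHi, ← integral_conj]
    exact (integral_prod_mul (fun γ => ∫ ω, H ω γ ∂P)
      (fun γ => starRingEnd ℂ (∫ ω, H ω γ ∂P))).symm

end Fubini

/-! ### The estimator and the variance factor -/

section Estimator

variable {G : Type*} [AddCommGroup G] {m : ℕ}

/-- A bound for `estimatorIntegrand` relative to the Fourier transform. -/
def estimatorBound (m : ℕ) (x : Fin 3 → ℤ → G) : ℝ≥0∞ :=
  ‖((((m : ℝ) ^ 3 * |Real.Gamma (-1 / 3)| ^ 3 : ℝ) : ℂ))⁻¹‖ₑ * 8 * ∏ j, weightSum m (x j)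

theorem estimatorBound_lt_top {x : Fin 3 → ℤ → G} (h : ∀ j, weightSum m (x j) < ∞) :
    estimatorBound m x < ∞ :=
  ENNReal.mul_lt_top (ENNReal.mul_lt_top enorm_lt_top (by simp))
    (ENNReal.prod_lt_top fun j _ => h j)

variable [TopologicalSpace G] [MeasurableSpace G] {μG : Measure G} {f : G → ℂ}

theorem enorm_estimatorIntegrand_le (x : Fin 3 → ℤ → G) (γ : Dual G) :
    ‖estimatorIntegrand μG f m x γ‖ₑ
      ≤ estimatorBound m x * ‖fourierTransform μG f γ‖ₑ := by
  rw [estimatorIntegrand, div_eq_mul_inv, enorm_mul, enorm_mul, mul_comm]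
  gcongr
  rw [estimatorBound, mul_comm, mul_assoc]
  gcongr
  rw [Fin.prod_univ_three, Fin.prod_univ_three, enorm_mul, enorm_mul]
  calc _ ≤ (2 * weightSum m (x 0)) * (2 * weightSum m (x 1)) * (2 * weightSum m (x 2)) := by
        gcongr <;> exact enorm_aggregation_le m _ γ
    _ = _ := by ring

/-- Joint measurability of the integrand from that of the pairings. -/
theorem aestronglyMeasurable_estimatorIntegrand {α : Type*} [MeasurableSpace α] {M : Measure α}
    {x : α → Fin 3 → ℤ → G} {γ : α → Dual G}
    (h : ∀ j k, AEStronglyMeasurable (fun a => pairing (x a j k) (γ a)) M)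
    (hw : ∀ᵐ a ∂M, ∀ j, weightSum m (x a j) < ∞)
    (hF : AEStronglyMeasurable (fun a => fourierTransform μG f (γ a)) M) :
    AEStronglyMeasurable (fun a => estimatorIntegrand μG f m (x a) (γ a)) M := by
  refine hF.mul ?_
  simp_rw [div_eq_mul_inv]
  refine AEStronglyMeasurable.mul_const ?_ _
  refine Finset.aestronglyMeasurable_fun_prod _ fun j _ => ?_
  exact aestronglyMeasurable_aggregation (h j) (hw.mono fun a ha => ha j)

variable [MeasurableSpace (Dual G)] [BorelSpace (Dual G)] {μΓ : Measure (Dual G)}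

theorem integrable_estimatorIntegrand (hF : Integrable (fourierTransform μG f) μΓ)
    {x : Fin 3 → ℤ → G} (h : ∀ j, weightSum m (x j) < ∞) :
    Integrable (estimatorIntegrand μG f m x) μΓ := by
  refine ⟨aestronglyMeasurable_estimatorIntegrand (x := fun _ => x) (γ := id) (fun j k => ?_)
    (Eventually.of_forall fun _ => h) hF.1, ?_⟩
  · exact (continuous_pairing_right (x j k)).aestronglyMeasurable
  · refine (lintegral_mono fun γ => enorm_estimatorIntegrand_le x γ).trans_lt ?_
    rw [lintegral_const_mul' _ _ (estimatorBound_lt_top h).ne]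
    exact ENNReal.mul_lt_top (estimatorBound_lt_top h) hF.2

end Estimator

section Kernel

variable {G : Type*} [AddCommGroup G] [TopologicalSpace G] [MeasurableSpace G]
  {μG : Measure G} {μR : Measure G} {f : G → ℂ}

/-- The kernel in terms of the exponents, in the notation of `exists_norm_covariance_sub_le`. -/
theorem varianceKernel_eq [IsProbabilityMeasure μR] (γ γ' : Dual G) :
    varianceKernel μG μR f γ γ' = fourierTransform μG f γ * starRingEnd ℂ (fourierTransform μG f γ')
      * ((exponent μR (γ * γ'⁻¹) ^ (2 / 3 : ℂ)
          - (exponent μR γ + starRingEnd ℂ (exponent μR γ')) ^ (2 / 3 : ℂ))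
        * exponent μR γ ^ (2 / 3 : ℂ) * starRingEnd ℂ (exponent μR γ') ^ (2 / 3 : ℂ)) := by
  have h1 : 1 - fourierStieltjes μR (γ⁻¹ * γ') = exponent μR (γ * γ'⁻¹) := by
    rw [fourierStieltjes, exponent, mul_inv_rev, inv_inv, mul_comm]
  have h2 : 1 - fourierStieltjes μR γ⁻¹ = exponent μR γ := by
    rw [fourierStieltjes, exponent, inv_inv]
  have h3 : 1 - fourierStieltjes μR γ' = starRingEnd ℂ (exponent μR γ') := by
    simp_rw [fourierStieltjes, exponent, pairing_inv]
    rw [integral_conj, map_sub, map_one]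
  have h4 : 2 - fourierStieltjes μR γ⁻¹ - fourierStieltjes μR γ'
      = exponent μR γ + starRingEnd ℂ (exponent μR γ') := by
    rw [← h2, ← h3]; ring
  rw [varianceKernel, h1, h2, h3, h4]
  ring

theorem norm_cpow_two_thirds_le {z : ℂ} (hz : ‖z‖ ≤ 4) : ‖z ^ (2 / 3 : ℂ)‖ ≤ 4 := by
  have e : (2 / 3 : ℂ) = ((2 / 3 : ℝ) : ℂ) := by push_cast; rfl
  rw [e, Complex.norm_cpow_real]
  calc ‖z‖ ^ (2 / 3 : ℝ) ≤ 4 ^ (2 / 3 : ℝ) := by gcongr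
    _ ≤ 4 ^ (1 : ℝ) := Real.rpow_le_rpow_of_exponent_le (by norm_num) (by norm_num)
    _ = 4 := Real.rpow_one 4

theorem norm_varianceKernel_le [IsProbabilityMeasure μR] (γ γ' : Dual G) :
    ‖varianceKernel μG μR f γ γ'‖
      ≤ 128 * (‖fourierTransform μG f γ‖ * ‖fourierTransform μG f γ'‖) := by
  rw [varianceKernel_eq, norm_mul, norm_mul, norm_mul, norm_mul, RCLike.norm_conj]
  have e : ∀ γ : Dual G, ‖exponent μR γ‖ ≤ 2 := norm_exponent_le
  have e' : ∀ γ : Dual G, ‖starRingEnd ℂ (exponent μR γ)‖ ≤ 2 := fun γ => by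
    rw [RCLike.norm_conj]; exact e γ
  calc _ ≤ ‖fourierTransform μG f γ‖ * ‖fourierTransform μG f γ'‖ * ((4 + 4) * 4 * 4) := by
        gcongr
        · refine (norm_sub_le _ _).trans (add_le_add ?_ ?_)
          · exact norm_cpow_two_thirds_le ((e _).trans (by norm_num))
          · exact norm_cpow_two_thirds_le ((norm_add_le _ _).trans (by linarith [e γ, e' γ']))
        · exact norm_cpow_two_thirds_le ((e _).trans (by norm_num))
        · exact norm_cpow_two_thirds_le ((e' _).trans (by norm_num))
    _ = _ := by ring

theorem aestronglyMeasurable_cpow_const {α : Type*} [MeasurableSpace α] {M : Measure α} {g : α → ℂ}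
    (hg : AEStronglyMeasurable g M) (c : ℂ) : AEStronglyMeasurable (fun a => g a ^ c) M :=
  (hg.aemeasurable.pow_const c).aestronglyMeasurable

/-- Measurability of the kernel, in whatever parameters it depends on. -/
theorem aestronglyMeasurable_varianceKernel [IsProbabilityMeasure μR] {α : Type*}
    [MeasurableSpace α] {M : Measure α} {γ γ' : α → Dual G}
    (h1 : AEStronglyMeasurable (fun a => fourierTransform μG f (γ a)) M)
    (h2 : AEStronglyMeasurable (fun a => fourierTransform μG f (γ' a)) M)
    (h3 : AEStronglyMeasurable (fun a => exponent μR (γ a)) M)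
    (h4 : AEStronglyMeasurable (fun a => exponent μR (γ' a)) M)
    (h5 : AEStronglyMeasurable (fun a => exponent μR (γ a * (γ' a)⁻¹)) M) :
    AEStronglyMeasurable (fun a => varianceKernel μG μR f (γ a) (γ' a)) M := by
  simp_rw [varianceKernel_eq]
  have hc : ∀ {g : α → ℂ}, AEStronglyMeasurable g M →
      AEStronglyMeasurable (fun a => starRingEnd ℂ (g a)) M := fun hg =>
    Complex.continuous_conj.comp_aestronglyMeasurable hg
  exact (h1.mul (hc h2)).mul ((((aestronglyMeasurable_cpow_const h5 _).sub
    (aestronglyMeasurable_cpow_const (h3.add (hc h4)) _)).mul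
    (aestronglyMeasurable_cpow_const h3 _)).mul (aestronglyMeasurable_cpow_const (hc h4) _))

end Kernel

section Measurability

variable {G : Type*} [AddCommGroup G] [TopologicalSpace G] [IsTopologicalAddGroup G]
  [LocallyCompactSpace G] [T2Space G] [MeasurableSpace G] [BorelSpace G]
  [MeasurableSpace (Dual G)] [BorelSpace (Dual G)]
  {μR : Measure G} [IsProbabilityMeasure μR] {ν : Measure (Dual G)} [SigmaFinite ν]
  {K : Set G} {L : Set (Dual G)}

theorem aestronglyMeasurable_pairing_swap (hK : IsSigmaCompact K) (hμ : μR Kᶜ = 0)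
    (hL : IsSigmaCompact L) (hν : ν Lᶜ = 0) :
    AEStronglyMeasurable (fun p : Dual G × G => pairing p.2 p.1) (ν.prod μR) :=
  (aestronglyMeasurable_pairing hK hμ hL hν).prod_swap

theorem aestronglyMeasurable_exponent (hK : IsSigmaCompact K) (hμ : μR Kᶜ = 0)
    (hL : IsSigmaCompact L) (hν : ν Lᶜ = 0) :
    AEStronglyMeasurable (fun γ : Dual G => exponent μR γ) ν :=
  aestronglyMeasurable_const.sub
    (aestronglyMeasurable_pairing_swap hK hμ hL hν).integral_prod_right'

theorem aestronglyMeasurable_exponent_mul_inv (hK : IsSigmaCompact K) (hμ : μR Kᶜ = 0)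
    (hL : IsSigmaCompact L) (hν : ν Lᶜ = 0) :
    AEStronglyMeasurable (fun p : Dual G × Dual G => exponent μR (p.1 * p.2⁻¹)) (ν.prod ν) := by
  have h := aestronglyMeasurable_pairing_swap hK hμ hL hν
  have h1 : AEStronglyMeasurable (fun q : (Dual G × Dual G) × G => pairing q.2 q.1.1)
      ((ν.prod ν).prod μR) :=
    h.comp_quasiMeasurePreserving (quasiMeasurePreserving_prodMap
      Measure.quasiMeasurePreserving_fst (Measure.QuasiMeasurePreserving.id μR))
  have h2 : AEStronglyMeasurable (fun q : (Dual G × Dual G) × G => pairing q.2 q.1.2)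
      ((ν.prod ν).prod μR) :=
    h.comp_quasiMeasurePreserving (quasiMeasurePreserving_prodMap
      Measure.quasiMeasurePreserving_snd (Measure.QuasiMeasurePreserving.id μR))
  simp only [exponent, pairing_mul_inv]
  exact aestronglyMeasurable_const.sub (AEStronglyMeasurable.integral_prod_right'
    (h1.mul (Complex.continuous_conj.comp_aestronglyMeasurable h2)))

theorem aestronglyMeasurable_exponent_mul_const_inv (hK : IsSigmaCompact K) (hμ : μR Kᶜ = 0)
    (hL : IsSigmaCompact L) (hν : ν Lᶜ = 0) (γ' : Dual G) :
    AEStronglyMeasurable (fun γ : Dual G => exponent μR (γ * γ'⁻¹)) ν := by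
  have h := aestronglyMeasurable_pairing_swap hK hμ hL hν
  simp only [exponent, pairing_mul_inv]
  refine aestronglyMeasurable_const.sub (AEStronglyMeasurable.integral_prod_right'
    (f := fun q : Dual G × G => pairing q.2 q.1 * starRingEnd ℂ (pairing q.2 γ'))
    (h.mul (Complex.continuous_conj.comp_aestronglyMeasurable ?_)))
  exact ((measurable_pairing γ').comp measurable_snd).aestronglyMeasurable

end Measurability

section Support

variable {G : Type*} [AddCommGroup G] [TopologicalSpace G] [MeasurableSpace G]
  [MeasurableSpace (Dual G)] {μG : Measure G} {μΓ : Measure (Dual G)} {μR : Measure G}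
  {f : G → ℂ} {L : Set (Dual G)} {m : ℕ}

theorem ae_forall_varianceKernel_eq_zero
    (h0 : ∀ᵐ γ ∂μΓ, γ ∉ L → fourierTransform μG f γ = 0) (γ' : Dual G) :
    ∀ᵐ γ ∂μΓ, γ ∉ L → varianceKernel μG μR f γ γ' = 0 := by
  filter_upwards [h0] with γ h hγ
  simp [varianceKernel, h hγ]

theorem ae_forall_integral_varianceKernel_eq_zero
    (h0 : ∀ᵐ γ ∂μΓ, γ ∉ L → fourierTransform μG f γ = 0) :
    ∀ᵐ γ' ∂μΓ, γ' ∉ L → ∫ γ, varianceKernel μG μR f γ γ' ∂μΓ = 0 := by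
  filter_upwards [h0] with γ' h hγ
  simp [varianceKernel, h hγ]

theorem integral_varianceKernel_eq_setIntegral
    (h0 : ∀ᵐ γ ∂μΓ, γ ∉ L → fourierTransform μG f γ = 0) (γ' : Dual G) :
    ∫ γ, varianceKernel μG μR f γ γ' ∂μΓ = ∫ γ in L, varianceKernel μG μR f γ γ' ∂μΓ :=
  (setIntegral_eq_integral_of_ae_compl_eq_zero (ae_forall_varianceKernel_eq_zero h0 γ')).symm

theorem estimator_eq_setIntegral (h0 : ∀ᵐ γ ∂μΓ, γ ∉ L → fourierTransform μG f γ = 0)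
    (x : Fin 3 → ℤ → G) :
    estimator μG μΓ f m x = ∫ γ in L, estimatorIntegrand μG f m x γ ∂μΓ := by
  refine (setIntegral_eq_integral_of_ae_compl_eq_zero ?_).symm
  filter_upwards [h0] with γ h hγ
  simp [estimatorIntegrand, h hγ]

end Support

section Bound

variable {G : Type*} [AddCommGroup G] [TopologicalSpace G] [T2Space G] [MeasurableSpace G]
  [BorelSpace G] {μR : Measure G} {Ω : Type*} [MeasurableSpace Ω] {P : Measure Ω}
  {lam : ℝ} {m : ℕ} {X : Fin 3 → ℤ → Ω → G}

theorem measurable_estimatorBound (hX : IsTriplePoissonTower P μR lam m X) :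
    Measurable fun ω => estimatorBound m (fun j k => X j k ω) :=
  (Finset.measurable_fun_prod _ fun j _ => measurable_weightSum_comp (hX.measurable j)).const_mul _

theorem lintegral_estimatorBound_sq_lt_top [IsProbabilityMeasure μR]
    [IsProbabilityMeasure P] (hX : IsTriplePoissonTower P μR lam m X)
    (hlam : 0 < lam) (hm : 1 ≤ m) :
    ∫⁻ ω, estimatorBound m (fun j k => X j k ω) ^ 2 ∂P < ∞ := by
  simp_rw [estimatorBound, mul_pow _ (∏ j, _)]
  rw [lintegral_const_mul' _ _ (ENNReal.pow_ne_top (ENNReal.mul_ne_top enorm_ne_top (by simp)))]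
  exact ENNReal.mul_lt_top (ENNReal.pow_lt_top (ENNReal.mul_lt_top enorm_lt_top (by simp)))
    (lintegral_prod_weightSum_sq_lt_top hX hlam hm)

end Bound

section Final

variable {G : Type*} [AddCommGroup G] [TopologicalSpace G] [IsTopologicalAddGroup G]
  [LocallyCompactSpace G] [T2Space G] [MeasurableSpace G] [BorelSpace G]
  [MeasurableSpace (Dual G)] [BorelSpace (Dual G)]
  {μG : Measure G} {μΓ : Measure (Dual G)} {μR : Measure G} [IsProbabilityMeasure μR]
  {f : G → ℂ} {K : Set G} {L : Set (Dual G)}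

theorem integrable_varianceKernel_left [SigmaFinite (μΓ.restrict L)]
    (hF : Integrable (fourierTransform μG f) μΓ)
    (hK : IsSigmaCompact K) (hμ : μR Kᶜ = 0) (hL : IsSigmaCompact L)
    (h0 : ∀ᵐ γ ∂μΓ, γ ∉ L → fourierTransform μG f γ = 0) (γ' : Dual G) :
    Integrable (fun γ => varianceKernel μG μR f γ γ') μΓ := by
  have hLm := measurableSet_of_isSigmaCompact hL
  have hν : μΓ.restrict L Lᶜ = 0 := by rw [Measure.restrict_apply hLm.compl]; simp
  have hFν : Integrable (fourierTransform μG f) (μΓ.restrict L) := hF.restrict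
  have h : IntegrableOn (fun γ => varianceKernel μG μR f γ γ') L μΓ := by
    refine Integrable.mono' ((hFν.norm.mul_const ‖fourierTransform μG f γ'‖).const_mul 128) ?_
      (Eventually.of_forall fun γ => norm_varianceKernel_le γ γ')
    exact aestronglyMeasurable_varianceKernel (γ' := fun _ => γ') hFν.1 aestronglyMeasurable_const
      (aestronglyMeasurable_exponent hK hμ hL hν) aestronglyMeasurable_const
      (aestronglyMeasurable_exponent_mul_const_inv hK hμ hL hν γ')
  exact h.integrable_of_ae_notMem_eq_zero (ae_forall_varianceKernel_eq_zero h0 γ')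

theorem integrable_varianceKernel_prod [SigmaFinite (μΓ.restrict L)]
    (hF : Integrable (fourierTransform μG f) μΓ)
    (hK : IsSigmaCompact K) (hμ : μR Kᶜ = 0) (hL : IsSigmaCompact L) :
    Integrable (fun p : Dual G × Dual G => varianceKernel μG μR f p.1 p.2)
      ((μΓ.restrict L).prod (μΓ.restrict L)) := by
  have hLm := measurableSet_of_isSigmaCompact hL
  have hν : μΓ.restrict L Lᶜ = 0 := by rw [Measure.restrict_apply hLm.compl]; simp
  have hFν : Integrable (fourierTransform μG f) (μΓ.restrict L) := hF.restrict
  refine Integrable.mono' ((hFν.norm.mul_prod hFν.norm).const_mul 128) ?_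
    (Eventually.of_forall fun p => norm_varianceKernel_le p.1 p.2)
  have he := aestronglyMeasurable_exponent hK hμ hL hν
  exact aestronglyMeasurable_varianceKernel hFν.1.comp_fst hFν.1.comp_snd he.comp_fst he.comp_snd
    (aestronglyMeasurable_exponent_mul_inv hK hμ hL hν)

theorem integrable_integral_varianceKernel [SigmaFinite (μΓ.restrict L)]
    (hF : Integrable (fourierTransform μG f) μΓ)
    (hK : IsSigmaCompact K) (hμ : μR Kᶜ = 0) (hL : IsSigmaCompact L)
    (h0 : ∀ᵐ γ ∂μΓ, γ ∉ L → fourierTransform μG f γ = 0) :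
    Integrable (fun γ' => ∫ γ, varianceKernel μG μR f γ γ' ∂μΓ) μΓ := by
  have h : IntegrableOn (fun γ' => ∫ γ, varianceKernel μG μR f γ γ' ∂μΓ) L μΓ := by
    simp_rw [integral_varianceKernel_eq_setIntegral h0]
    exact (integrable_varianceKernel_prod hF hK hμ hL).integral_prod_right
  exact h.integrable_of_ae_notMem_eq_zero (ae_forall_integral_varianceKernel_eq_zero h0)

theorem varianceFactor_eq [SigmaFinite (μΓ.restrict L)]
    (hF : Integrable (fourierTransform μG f) μΓ)
    (hK : IsSigmaCompact K) (hμ : μR Kᶜ = 0) (hL : IsSigmaCompact L)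
    (h0 : ∀ᵐ γ ∂μΓ, γ ∉ L → fourierTransform μG f γ = 0) :
    varianceFactor μG μΓ μR f = -∫ p : Dual G × Dual G, varianceKernel μG μR f p.1 p.2
      ∂((μΓ.restrict L).prod (μΓ.restrict L)) := by
  rw [varianceFactor, ← setIntegral_eq_integral_of_ae_compl_eq_zero
    (ae_forall_integral_varianceKernel_eq_zero h0)]
  simp_rw [integral_varianceKernel_eq_setIntegral h0]
  rw [integral_prod_symm _ (integrable_varianceKernel_prod hF hK hμ hL)]

variable {Ω : Type*} [MeasurableSpace Ω] {P : Measure Ω} [IsProbabilityMeasure P]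
  {lam : ℝ} {m : ℕ} {X : Fin 3 → ℤ → Ω → G}

theorem aestronglyMeasurable_uncurry_estimatorIntegrand [SigmaFinite (μΓ.restrict L)]
    (hX : IsTriplePoissonTower P μR lam m X) (hlam : 0 < lam) (hm : 1 ≤ m)
    (hF : Integrable (fourierTransform μG f) μΓ)
    (hK : IsSigmaCompact K) (hcp : ∀ t, compoundPoisson t μR Kᶜ = 0) (hL : IsSigmaCompact L) :
    AEStronglyMeasurable (Function.uncurry fun (ω : Ω) (γ : Dual G) =>
      estimatorIntegrand μG f m (fun j k => X j k ω) γ) (P.prod (μΓ.restrict L)) := by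
  have hLm := measurableSet_of_isSigmaCompact hL
  have hν : μΓ.restrict L Lᶜ = 0 := by rw [Measure.restrict_apply hLm.compl]; simp
  have hFν : Integrable (fourierTransform μG f) (μΓ.restrict L) := hF.restrict
  refine aestronglyMeasurable_estimatorIntegrand (x := fun q : Ω × Dual G => fun j k => X j k q.1)
    (γ := Prod.snd) (fun j k => ?_) ?_ hFν.1.comp_snd
  · exact aestronglyMeasurable_pairing_comp (hX.measurable j k) hK (hX.law j k ▸ hcp _) hL hν
  · exact Measure.quasiMeasurePreserving_fst.ae (ae_forall_weightSum_lt_top hX hlam hm)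

end Final

/-! ### The covariances of the integrand -/

section Covariance

variable {G : Type*} [AddCommGroup G] [TopologicalSpace G] [IsTopologicalAddGroup G]
  [T2Space G] [MeasurableSpace G] [BorelSpace G]
  {μG : Measure G} {μR : Measure G} [IsProbabilityMeasure μR] {f : G → ℂ}
  {Ω : Type*} [MeasurableSpace Ω] {P : Measure Ω} [IsProbabilityMeasure P]
  {lam : ℝ} {m : ℕ} {X : Fin 3 → ℤ → Ω → G}

theorem integral_estimatorIntegrand (hX : IsTriplePoissonTower P μR lam m X) (hlam : 0 < lam)
    (hm : 1 ≤ m) (γ : Dual G) :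
    ∫ ω, estimatorIntegrand μG f m (fun j k => X j k ω) γ ∂P
      = fourierTransform μG f γ * (laplaceSum (1 / 3) m (lam * exponent μR γ) ^ 3
        / (((m : ℝ) ^ 3 * |Real.Gamma (-1 / 3)| ^ 3 : ℝ) : ℂ)) := by
  simp only [estimatorIntegrand]
  rw [integral_const_mul, integral_div, integral_prod_aggregation hX hlam hm]

theorem integral_estimatorIntegrand_mul_conj (hX : IsTriplePoissonTower P μR lam m X)
    (hlam : 0 < lam) (hm : 1 ≤ m) (γ γ' : Dual G) :
    ∫ ω, estimatorIntegrand μG f m (fun j k => X j k ω) γ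
        * starRingEnd ℂ (estimatorIntegrand μG f m (fun j k => X j k ω) γ') ∂P
      = fourierTransform μG f γ * starRingEnd ℂ (fourierTransform μG f γ')
        * ((laplaceSum (1 / 3) m (lam * exponent μR γ)
            * laplaceSum (1 / 3) m (lam * starRingEnd ℂ (exponent μR γ'))
          + (laplaceSum (2 / 3) m (lam * exponent μR (γ * γ'⁻¹))
            - laplaceSum (2 / 3) m
                (lam * (exponent μR γ + starRingEnd ℂ (exponent μR γ'))))) ^ 3
          / ((((m : ℝ) ^ 3 * |Real.Gamma (-1 / 3)| ^ 3 : ℝ) : ℂ)) ^ 2) := by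
  rw [← integral_prod_aggregation_mul_conj hX hlam hm, ← integral_div, ← integral_const_mul]
  refine integral_congr_ae (Eventually.of_forall fun ω => ?_)
  simp only [estimatorIntegrand, map_mul, map_div₀, Complex.conj_ofReal]
  ring

end Covariance

/-- The covariances of the integrand are approximated by the variance kernel. -/
theorem exists_norm_covariance_estimatorIntegrand_sub_le : ∃ C : ℝ, 0 ≤ C ∧
    ∀ (G : Type*) [AddCommGroup G] [TopologicalSpace G] [IsTopologicalAddGroup G]
      [T2Space G] [MeasurableSpace G] [BorelSpace G]
      (μG : Measure G) (μR : Measure G) [IsProbabilityMeasure μR] (f : G → ℂ)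
      (lam : ℝ) (_ : 0 < lam) (m : ℕ) (_ : 1 ≤ m)
      (Ω : Type*) [MeasurableSpace Ω] (P : Measure Ω) [IsProbabilityMeasure P]
      (X : Fin 3 → ℤ → Ω → G) (_ : IsTriplePoissonTower P μR lam m X) (γ γ' : Dual G),
      ‖((∫ ω, estimatorIntegrand μG f m (fun j k => X j k ω) γ
            * starRingEnd ℂ (estimatorIntegrand μG f m (fun j k => X j k ω) γ') ∂P)
          - (∫ ω, estimatorIntegrand μG f m (fun j k => X j k ω) γ ∂P)
            * starRingEnd ℂ (∫ ω, estimatorIntegrand μG f m (fun j k => X j k ω) γ' ∂P))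
          - 3 * (m : ℂ)⁻¹ * (lam : ℂ) ^ 2 * (Real.Gamma (-2 / 3) : ℂ)
            * ((Real.Gamma (-1 / 3) : ℂ) ^ 2)⁻¹ * varianceKernel μG μR f γ γ'‖
        ≤ C * lam ^ 2 / (m : ℝ) ^ 2
          * (‖fourierTransform μG f γ‖ * ‖fourierTransform μG f γ'‖) := by
  obtain ⟨C, hC0, hC⟩ := exists_norm_covariance_sub_le
  refine ⟨C, hC0, ?_⟩
  intro G _ _ _ _ _ _ μG μR _ f lam hlam m hm Ω _ P _ X hX γ γ'
  have h := hC lam m (exponent μR γ) (starRingEnd ℂ (exponent μR γ')) (exponent μR (γ * γ'⁻¹))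
    hlam (by exact_mod_cast hm) (exponent_re_nonneg γ) (norm_exponent_sq_le γ)
    (by rw [Complex.conj_re]; exact exponent_re_nonneg γ')
    (by rw [Complex.conj_re, RCLike.norm_conj]; exact norm_exponent_sq_le γ')
    (exponent_re_nonneg _) (norm_exponent_sq_le _) (norm_exponent_mul_inv_sub_sq_le γ γ')
  rw [integral_estimatorIntegrand_mul_conj hX hlam hm, integral_estimatorIntegrand hX hlam hm,
    integral_estimatorIntegrand hX hlam hm, varianceKernel_eq]
  simp only [map_mul, map_div₀, map_pow, Complex.conj_ofReal, conj_laplaceSum]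
  rw [Complex.ofReal_natCast] at h
  refine le_of_eq_of_le ?_ (mul_le_mul_of_nonneg_right h
    (by positivity : 0 ≤ ‖fourierTransform μG f γ‖ * ‖fourierTransform μG f γ'‖))
  rw [← RCLike.norm_conj (fourierTransform μG f γ'), ← norm_mul, ← norm_mul]
  congr 1
  ring

end PoissonTower

end

theorem mainTheorem4 :
    ∃ C : ℝ,
      ∀ (G : Type*) [AddCommGroup G] [TopologicalSpace G] [IsTopologicalAddGroup G]
        [LocallyCompactSpace G] [T2Space G] [MeasurableSpace G] [BorelSpace G]
        [MeasurableSpace (PoissonTower.Dual G)] [BorelSpace (PoissonTower.Dual G)]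
        -- regular Haar measures on `G` and on its dual group, in any normalization
        (μG : Measure G) [μG.IsAddHaarMeasure] [μG.Regular]
        (μΓ : Measure (PoissonTower.Dual G)) [μΓ.IsHaarMeasure] [μΓ.Regular]
        -- the law of `R`: a Radon probability measure without mass at `0`
        (μR : Measure G) [IsProbabilityMeasure μR] [μR.Regular] (_ : μR {0} = 0)
        (f : G → ℂ) (_ : PoissonTower.IsRegularFunction μG μΓ f)
        (lam : ℝ) (_ : 0 < lam) (m : ℕ) (_ : 1 ≤ m)
        (Ω : Type*) [MeasurableSpace Ω] (P : Measure Ω) [IsProbabilityMeasure P]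
        (X : Fin 3 → ℤ → Ω → G) (_ : PoissonTower.IsTriplePoissonTower P μR lam m X),
        -- the series and the integrals that occur below converge absolutely
        (∀ᵐ ω ∂P, ∀ (j : Fin 3) (γ : PoissonTower.Dual G),
          Summable (PoissonTower.aggregationTerm m (fun k => X j k ω) γ)) ∧
        (∀ᵐ ω ∂P,
          Integrable (PoissonTower.estimatorIntegrand μG f m (fun j k => X j k ω)) μΓ) ∧
        MemLp (fun ω => PoissonTower.estimator μG μΓ f m (fun j k => X j k ω)) 2 P ∧
        (∀ γ', Integrable (fun γ => PoissonTower.varianceKernel μG μR f γ γ') μΓ) ∧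
        Integrable (fun γ' => ∫ γ, PoissonTower.varianceKernel μG μR f γ γ' ∂μΓ) μΓ ∧
        -- the variance formula, with an absolute constant in the error term
        ‖PoissonTower.complexVariance P
              (fun ω => PoissonTower.estimator μG μΓ f m (fun j k => X j k ω))
            - 3 * (m : ℂ)⁻¹ * (lam : ℂ) ^ 2 * (-(Real.Gamma (-2 / 3) : ℂ))
              * ((Real.Gamma (-1 / 3) : ℂ) ^ 2)⁻¹ * PoissonTower.varianceFactor μG μΓ μR f‖
          ≤ C * lam ^ 2 * (∫ γ, ‖PoissonTower.fourierTransform μG f γ‖ ∂μΓ) ^ 2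
              / (m : ℝ) ^ 2 := by
  obtain ⟨C, hC0, hC⟩ := PoissonTower.exists_norm_covariance_estimatorIntegrand_sub_le
  refine ⟨C, ?_⟩
  intro G _ _ _ _ _ _ _ _ _ μG _ _ μΓ _ _ μR _ _ _ f hf lam hlam m hm Ω _ P _ X hX
  have hF := hf.integrable_fourier
  -- all integrals live on σ-compact sets, on which the measures are σ-finite
  obtain ⟨L, hL, h0⟩ := PoissonTower.exists_isSigmaCompact_forall_notMem_eq_zero hF
  obtain ⟨K, hK, hμ, hcp⟩ :=
    PoissonTower.exists_isSigmaCompact_compoundPoisson_compl (μ := μR)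
  have := PoissonTower.sigmaFinite_restrict_of_isSigmaCompact (μ := μΓ) hL
  have hw := PoissonTower.ae_forall_weightSum_lt_top hX hlam hm
  have hH := PoissonTower.aestronglyMeasurable_uncurry_estimatorIntegrand hX hlam hm hF hK hcp hL
  have hW := (PoissonTower.measurable_estimatorBound hX).aemeasurable (μ := P)
  have hW2 := PoissonTower.lintegral_estimatorBound_sq_lt_top hX hlam hm
  have hFL := hF.restrict (s := L)
  have hb := fun ω => PoissonTower.enorm_estimatorIntegrand_le (μG := μG) (f := f) (m := m)
    (fun j k => X j k ω)
  have hest : (fun ω => PoissonTower.estimator μG μΓ f m (fun j k => X j k ω)) = fun ω =>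
      ∫ γ in L, PoissonTower.estimatorIntegrand μG f m (fun j k => X j k ω) γ ∂μΓ :=
    funext fun ω => PoissonTower.estimator_eq_setIntegral h0 _
  refine ⟨?_, ?_, ?_, PoissonTower.integrable_varianceKernel_left hF hK hμ hL h0,
    PoissonTower.integrable_integral_varianceKernel hF hK hμ hL h0, ?_⟩
  · filter_upwards [hw] with ω h j γ using PoissonTower.summable_aggregationTerm (h j) γ
  · filter_upwards [hw] with ω h using PoissonTower.integrable_estimatorIntegrand hF h
  · rw [hest]
    exact PoissonTower.memLp_two_integral_of_enorm_le hH hW2 hFL hb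
  · obtain ⟨hi, he⟩ := PoissonTower.complexVariance_integral_eq hH hW hW2 hFL hb
    have hk := PoissonTower.integrable_varianceKernel_prod hF hK hμ hL
    rw [hest, he, PoissonTower.varianceFactor_eq hF hK hμ hL h0]
    set c : ℂ := 3 * (m : ℂ)⁻¹ * (lam : ℂ) ^ 2 * (Real.Gamma (-2 / 3) : ℂ)
      * ((Real.Gamma (-1 / 3) : ℂ) ^ 2)⁻¹ with hc
    have hneg : ∀ z : ℂ, 3 * (m : ℂ)⁻¹ * (lam : ℂ) ^ 2 * (-(Real.Gamma (-2 / 3) : ℂ))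
        * ((Real.Gamma (-1 / 3) : ℂ) ^ 2)⁻¹ * -z = c * z := fun z => by rw [hc]; ring
    rw [hneg, ← integral_const_mul, ← integral_sub hi (hk.const_mul c)]
    refine (norm_integral_le_of_norm_le ((hFL.norm.mul_prod hFL.norm).const_mul
      (C * lam ^ 2 / (m : ℝ) ^ 2)) (Filter.Eventually.of_forall fun p =>
        hC G μG μR f lam hlam m hm Ω P X hX p.1 p.2)).trans ?_
    rw [integral_const_mul, integral_prod_mul (fun γ => ‖PoissonTower.fourierTransform μG f γ‖)
      (fun γ => ‖PoissonTower.fourierTransform μG f γ‖), ← pow_two]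
    have hle : ∫ γ in L, ‖PoissonTower.fourierTransform μG f γ‖ ∂μΓ
        ≤ ∫ γ, ‖PoissonTower.fourierTransform μG f γ‖ ∂μΓ :=
      setIntegral_le_integral hF.norm (Filter.Eventually.of_forall fun γ => norm_nonneg _)
    calc _ ≤ C * lam ^ 2 / (m : ℝ) ^ 2
          * (∫ γ, ‖PoissonTower.fourierTransform μG f γ‖ ∂μΓ) ^ 2 := by gcongr
      _ = _ := by ring
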